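/- **The calculus $\lambda^*_\varepsilon$.** Fix base types $B$ with constants $c\in B$, among them $\mathsf{unit}\in\mathsf{Unit}$ and the allocation capability $\omega\in\mathsf{Alloc}$. Qualifiers, effects and observations $p,q,r,\varepsilon,\varphi$ are finite sets of variables and store locations. Values, terms and types are $$v::=c\mid\lambda x.t\mid\ell,\qquad t::=v\mid x\mid t\,t\mid\mathbf{ref}_t\,t\mid{!t}\mid t:=t\mid\mathbf{let}\;x=t\;\mathbf{in}\;t,\qquad T::=B\mid\mathsf{Ref}\,B\mid(x:T^{p})\to^{\varepsilon}U^{r},$$ where in the function type $x$ is bound in $\varepsilon,U,r$. A typing environment $\Gamma$ is a sequence of assumptions $x:T^q$, and a store typing $\Sigma$ is a finite map from locations to qualified types $T^q$ that mention only locations bound in $\Sigma$. $\Sigma'\supseteq\Sigma$ is extension of maps. Relative to $\Gamma,\Sigma$, an atom (variable or location) bound with qualifier $q$ reaches every member of $q$, and $q^*$ is the set of atoms reachable from $q$ in zero or more steps. $q[p/x]$ is $(q\setminus\{x\})\cup p$ if $x\in q$, and $q$ otherwise. *Subtyping.* $\Gamma\mid\Sigma\vdash p<:q$ iff $p\subseteq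 q\subseteq\mathrm{dom}(\Gamma)\cup\mathrm{dom}(\Sigma)$. $\Gamma\mid\Sigma\vdash S^p\,\varepsilon_1<:T^q\,\varepsilon_2$ iff $S<:T$, $p<:q$ and $\varepsilon_1<:\varepsilon_2$. Base and reference types are subtypes only of themselves; $(x:S^o)\to^{\varepsilon_1}T^q<:(x:U^p)\to^{\varepsilon_2}V^r$ if $\Gamma\mid\Sigma\vdash U^p\,\varnothing<:S^o\,\varnothing$ and $\Gamma,x:U^p\mid\Sigma\vdash T^q\,\varepsilon_1<:V^r\,\varepsilon_2$. *Typing* $[\Gamma\mid\Sigma]^\varphi\vdash t:T^q\;\varepsilon$ is generated by the following rules (context $[\Gamma\mid\Sigma]^\varphi$ unless shown). - $c:B^\varnothing\,\varnothing$ if $c\in B$; $x:T^{x}\,\varnothing$ if $x:T^q\in\Gamma$ and $x\in\varphi$; $\ell:T^{\ell}\,\varnothing$ if $\ell:T^q\in\Sigma$ and $\ell\in\varphi$. - $\lambda x.t:((x:T^p)\to^\varepsilon U^r)^q\,\varnothing$ if $[\Gamma,x:T^p\mid\Sigma]^{q,x}\vdash t:U^r\,\varepsilon$, $q\subseteq\varphi$,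 and $T^p$ mentions only variables and locations bound in $\Gamma,\Sigma$. - $t_1\,t_2:(U^{r}\;\varepsilon_1\cup\varepsilon_2\cup\varepsilon_3)[p/x]$ if $t_1:((x:T^{p^*\cap q^*})\to^{\varepsilon_3}U^r)^q\,\varepsilon_1$, $t_2:T^p\,\varepsilon_2$, $p^*\subseteq\varphi$, $q^*\subseteq\varphi$, $x\notin\mathrm{fv}(U)$, $\varepsilon_3\subseteq q,x$ and $r\subseteq\varphi,x$. - $\mathbf{let}\;x=t_1\;\mathbf{in}\;t_2:(T^q\;\varepsilon_1\cup\varepsilon_2)[p/x]$ if $t_1:S^p\,\varepsilon_1$, $[\Gamma,x:S^{p^*\cap\varphi^*}\mid\Sigma]^{\varphi,x}\vdash t_2:T^q\,\varepsilon_2$ and $x\notin\mathrm{fv}(T)$. - $\mathbf{ref}_{t_1}\,t_2:(\mathsf{Ref}\,B)^\varnothing\;\varepsilon_1\cup\varepsilon_2\cup q$ if $t_1:\mathsf{Alloc}^q\,\varepsilon_1$ and $t_2:B^\varnothing\,\varepsilon_2$; $\;!t:B^\varnothing\;\varepsilon\cup q$ if $t:(\mathsf{Ref}\,B)^q\,\varepsilon$;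 $\;t_1:=t_2:\mathsf{Unit}^\varnothing\;\varepsilon_1\cup\varepsilon_2\cup q$ if $t_1:(\mathsf{Ref}\,B)^q\,\varepsilon_1$ and $t_2:B^\varnothing\,\varepsilon_2$. - $t:T^q\,\varepsilon_2$ if $t:S^p\,\varepsilon_1$, $\Gamma\mid\Sigma\vdash S^p\,\varepsilon_1<:T^q\,\varepsilon_2$ and $q,\varepsilon_2\subseteq\varphi$. *Stores and reduction.* A store $\sigma$ is a sequence of bindings $\ell=\omega$ or $\ell=\mathbf{ref}_\omega\,v$. Well-formedness $[\Gamma\mid\Sigma]^\varphi\vdash\sigma$ holds for the empty store with empty $\Sigma$, for a single binding $w=\omega$ with $\Sigma=\{w:\mathsf{Alloc}^\varnothing\}$, and is preserved by appending $\ell=\mathbf{ref}_\omega\,v$ and adding $\ell:(\mathsf{Ref}\,B)^\varnothing$ to $\Sigma$, when $\ell\notin\mathrm{dom}(\Sigma)$ and $[\Gamma\mid\Sigma]^\varphi\vdash v:B^\varnothing\,\varnothing$. Evaluation contexts are $E::=\square\mid E\,t\mid v\,E\mid\mathbf{ref}_E\,t\mid\mathbf{ref}_v\,E\mid{!E}\mid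 E:=t\mid v:=E\mid\mathbf{let}\;x=E\;\mathbf{in}\;t$. The one-step relation $\sigma\mid t\longrightarrow\sigma'\mid t'$ is given by $$\sigma\mid E[(\lambda x.t)\,v]\longrightarrow\sigma\mid E[t[v/x]],\qquad \sigma\mid E[\mathbf{let}\;x=v\;\mathbf{in}\;t]\longrightarrow\sigma\mid E[t[v/x]],$$ $$\sigma\mid E[\mathbf{ref}_a\,v]\longrightarrow\sigma,\ell=\mathbf{ref}_\omega\,v\mid E[\ell]\quad(\ell\notin\mathrm{dom}(\sigma),\ a=\omega\text{ or }a\text{ a location bound to }\omega\text{ in }\sigma),$$ $$\sigma\mid E[!\ell]\longrightarrow\sigma\mid E[v]\quad(\ell=\mathbf{ref}_\omega\,v\text{ in }\sigma),$$ $$\sigma_1,\ell=\mathbf{ref}_\omega\,v,\sigma_2\mid E[\ell:=v']\longrightarrow\sigma_1,\ell=\mathbf{ref}_\omega\,v',\sigma_2\mid E[\mathsf{unit}].$$ **Corollary (Preservation of Separation).** Suppose $$[\varnothing\mid\Sigma]^{\mathrm{dom}(\Sigma)}\vdash t_1:T_1^{q_1}\;\varepsilon_1,\qquad [\varnothing\mid\Sigma]^{\mathrm{dom}(\Sigma)}\vdash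 t_2:T_2^{q_2}\;\varepsilon_2,\qquad [\varnothing\mid\Sigma]^{\mathrm{dom}(\Sigma)}\vdash\sigma,$$ $$\sigma\mid t_1\longrightarrow\sigma'\mid t_1',\qquad \sigma'\mid t_2\longrightarrow\sigma''\mid t_2',\qquad q_1\cap q_2=\varnothing .$$ Then there exist qualifiers $p_1,p_2$, effects $\varepsilon_1',\varepsilon_2'$ and store typings $\Sigma''\supseteq\Sigma'\supseteq\Sigma$ such that $$[\varnothing\mid\Sigma']^{\mathrm{dom}(\Sigma')}\vdash t_1':T_1^{p_1}\;\varepsilon_1',\qquad [\varnothing\mid\Sigma'']^{\mathrm{dom}(\Sigma'')}\vdash t_2':T_2^{p_2}\;\varepsilon_2',\qquad p_1\cap p_2=\varnothing .$$ -/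

import Mathlib

namespace LambdaStar

/-- Base types and constants. `mem c B` is `c ∈ B`. Among the base types are `Unit` (inhabited by
the constant `unit`) and `Alloc` (inhabited by the allocation capability `omega`). -/
structure Sig where
  Base : Type
  Const : Type
  mem : Const → Base → Prop
  unitTy : Base
  allocTy : Base
  unit : Const
  omega : Const
  unit_mem : mem unit unitTy
  omega_mem : mem omega allocTy

/-- Store locations. -/
abbrev Loc := ℕ

/-- Variables (de Bruijn indices, left summand) and locations (right summand). -/
abbrev Atom := ℕ ⊕ Loc

/-- Qualifiers, effects and observations: finite sets of variables and locations. -/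
abbrev Qual := Finset Atom

/-- The atom of the variable with de Bruijn index `i`. -/
abbrev avar (i : ℕ) : Atom := Sum.inl i

/-- The atom of the location `l`. -/
abbrev aloc (l : Loc) : Atom := Sum.inr l

/-- Extend a renaming of variables under one binder. -/
def liftRen (ρ : ℕ → ℕ) : ℕ → ℕ
  | 0 => 0
  | i + 1 => ρ i + 1

/-! ### Qualifiers -/

namespace Qual

/-- Rename the variables of a qualifier. -/
def rename (ρ : ℕ → ℕ) (q : Qual) : Qual := q.image (Sum.map ρ id)

/-- Weaken a qualifier by one (innermost) variable. -/
def shift (q : Qual) : Qual := rename Nat.succ q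

/-- The qualifier `q, x`, where `q` lives outside the scope of the innermost variable `x`. -/
def withVar (q : Qual) : Qual := insert (avar 0) (shift q)

/-- The atoms that replace an atom under `[p/x]`, `x` the innermost variable. -/
def instAtom (p : Qual) : Atom → Qual
  | Sum.inl 0 => p
  | Sum.inl (i + 1) => {avar i}
  | Sum.inr l => {aloc l}

/-- Qualifier substitution `q[p/x]` for the innermost variable `x`, which is then out of scope. -/
def inst (p q : Qual) : Qual := q.biUnion (instAtom p)

end Qual

/-- `dom(Γ) ∪ dom(Σ)` for a context of length `n` and a store typing with domain `D`. -/
def domAtoms (n : ℕ) (D : Finset Loc) : Qual := (Finset.range n).image avar ∪ D.image aloc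

/-! ### Types -/

/-- Types. In `arr T p ε U r`, that is `(x : T^p) →^ε U^r`, the variable `x` is bound in `ε`, `U`
and `r`, where it has index `0`. -/
inductive Ty (S : Sig) : Type where
  | base (B : S.Base) : Ty S
  | ref (B : S.Base) : Ty S
  | arr (T : Ty S) (p : Qual) (ε : Qual) (U : Ty S) (r : Qual) : Ty S

namespace Ty

variable {S : Sig}

/-- Rename the free variables of a type. -/
def rename : (ℕ → ℕ) → Ty S → Ty S
  | _, base B => base B
  | _, ref B => ref B
  | ρ, arr T p ε U r =>
      arr (rename ρ T) (Qual.rename ρ p) (Qual.rename (liftRen ρ) ε)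
        (rename (liftRen ρ) U) (Qual.rename (liftRen ρ) r)

/-- Weaken a type by one (innermost) variable. The types in which the innermost variable does not
occur free are those of the form `shift U`. -/
def shift (T : Ty S) : Ty S := rename Nat.succ T

/-- All qualifiers and effects in a type mention only variables and locations in scope. -/
def Scoped : ℕ → Finset Loc → Ty S → Prop
  | _, _, base _ => True
  | _, _, ref _ => True
  | n, D, arr T p ε U r =>
      Scoped n D T ∧ p ⊆ domAtoms n D ∧ ε ⊆ domAtoms (n + 1) D ∧
        Scoped (n + 1) D U ∧ r ⊆ domAtoms (n + 1) D

end Ty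

/-! ### Terms -/

/-- Terms, with de Bruijn indices. `lam t` binds in `t`; `letin t₁ t₂` is `let x = t₁ in t₂` and
binds in `t₂`; `ref t₁ t₂` is the allocation of a cell holding `t₂` with the capability `t₁`. -/
inductive Tm (S : Sig) : Type where
  | cst (c : S.Const) : Tm S
  | loc (l : Loc) : Tm S
  | var (i : ℕ) : Tm S
  | lam (t : Tm S) : Tm S
  | app (t₁ t₂ : Tm S) : Tm S
  | ref (t₁ t₂ : Tm S) : Tm S
  | deref (t : Tm S) : Tm S
  | assign (t₁ t₂ : Tm S) : Tm S
  | letin (t₁ t₂ : Tm S) : Tm S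

namespace Tm

variable {S : Sig}

/-- Rename the free variables of a term. -/
def rename : (ℕ → ℕ) → Tm S → Tm S
  | _, cst c => cst c
  | _, loc l => loc l
  | ρ, var i => var (ρ i)
  | ρ, lam t => lam (rename (liftRen ρ) t)
  | ρ, app t₁ t₂ => app (rename ρ t₁) (rename ρ t₂)
  | ρ, ref t₁ t₂ => ref (rename ρ t₁) (rename ρ t₂)
  | ρ, deref t => deref (rename ρ t)
  | ρ, assign t₁ t₂ => assign (rename ρ t₁) (rename ρ t₂)
  | ρ, letin t₁ t₂ => letin (rename ρ t₁) (rename (liftRen ρ) t₂)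

/-- Extend a substitution under one binder. -/
def liftSub (s : ℕ → Tm S) : ℕ → Tm S
  | 0 => var 0
  | i + 1 => rename Nat.succ (s i)

/-- Simultaneous capture-avoiding substitution. -/
def subst : (ℕ → Tm S) → Tm S → Tm S
  | _, cst c => cst c
  | _, loc l => loc l
  | s, var i => s i
  | s, lam t => lam (subst (liftSub s) t)
  | s, app t₁ t₂ => app (subst s t₁) (subst s t₂)
  | s, ref t₁ t₂ => ref (subst s t₁) (subst s t₂)
  | s, deref t => deref (subst s t)
  | s, assign t₁ t₂ => assign (subst s t₁) (subst s t₂)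
  | s, letin t₁ t₂ => letin (subst s t₁) (subst (liftSub s) t₂)

/-- The substitution of `v` for the innermost variable. -/
def instSub (v : Tm S) : ℕ → Tm S
  | 0 => v
  | i + 1 => var i

/-- `t[v/x]` for the innermost variable `x` of `t`. -/
def inst (v t : Tm S) : Tm S := subst (instSub v) t

/-- Values: constants, abstractions and locations. -/
inductive IsValue : Tm S → Prop
  | cst (c : S.Const) : IsValue (cst c)
  | lam (t : Tm S) : IsValue (lam t)
  | loc (l : Loc) : IsValue (loc l)

end Tm

/-! ### Environments -/

/-- Typing environments, innermost variable first. Every entry lives in the scope of the entries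
after it. -/
abbrev Ctx (S : Sig) := List (Ty S × Qual)

/-- `InCtx Γ x T q` is `x : T^q ∈ Γ`, with `T` and `q` read in the scope of all of `Γ`. -/
inductive InCtx {S : Sig} : Ctx S → ℕ → Ty S → Qual → Prop
  | zero (Γ : Ctx S) (T : Ty S) (q : Qual) : InCtx ((T, q) :: Γ) 0 T.shift q.shift
  | succ {Γ : Ctx S} {i : ℕ} {T : Ty S} {q : Qual} (b : Ty S × Qual) (h : InCtx Γ i T q) :
      InCtx (b :: Γ) (i + 1) T.shift q.shift

/-- Store typings: finite maps from locations to qualified types. -/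
abbrev StoreTy (S : Sig) := Finmap (fun _ : Loc => Ty S × Qual)

namespace StoreTy

variable {S : Sig}

/-- `dom(Σ)` as a set of locations. -/
def dom (St : StoreTy S) : Finset Loc := St.keys

/-- `dom(Σ)` as an observation. -/
def obs (St : StoreTy S) : Qual := St.dom.image aloc

/-- `Σ' ⊇ Σ`. -/
def Extends (St' St : StoreTy S) : Prop :=
  ∀ (l : Loc) (b : Ty S × Qual), St.lookup l = some b → St'.lookup l = some b

/-- The qualified types in a store typing mention no variables, and only locations bound in it. -/
def WellScoped (St : StoreTy S) : Prop :=
  ∀ (l : Loc) (T : Ty S) (q : Qual), St.lookup l = some (T, q) →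
    T.Scoped 0 St.dom ∧ q ⊆ domAtoms 0 St.dom

end StoreTy

/-- `dom(Γ) ∪ dom(Σ)`. -/
def domOf {S : Sig} (Γ : Ctx S) (St : StoreTy S) : Qual := domAtoms Γ.length St.dom

/-! ### Reachability -/

/-- One-step reachability: an atom reaches the members of the qualifier that it is bound with. -/
inductive Reach {S : Sig} (Γ : Ctx S) (St : StoreTy S) : Atom → Atom → Prop
  | var {i : ℕ} {T : Ty S} {q : Qual} {b : Atom} (h : InCtx Γ i T q) (hb : b ∈ q) :
      Reach Γ St (avar i) b
  | loc {l : Loc} {T : Ty S} {q : Qual} {b : Atom} (h : St.lookup l = some (T, q)) (hb : b ∈ q) :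
      Reach Γ St (aloc l) b

/-- Saturation `q*`: everything reachable from `q` in zero or more steps. -/
def sat {S : Sig} (Γ : Ctx S) (St : StoreTy S) (q : Qual) : Set Atom :=
  {b | ∃ a ∈ q, Relation.ReflTransGen (Reach Γ St) a b}

/-! ### Subtyping -/

/-- Qualifier (and effect) subtyping `Γ | Σ ⊢ p <: q`. -/
def QSub {S : Sig} (Γ : Ctx S) (St : StoreTy S) (p q : Qual) : Prop :=
  p ⊆ q ∧ q ⊆ domOf Γ St

/-- Subtyping `Γ | Σ ⊢ T <: T'` of ordinary types. The subtyping of qualified types is unfolded in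
the rule for functions, see `SubQ`. -/
inductive Sub {S : Sig} : Ctx S → StoreTy S → Ty S → Ty S → Prop
  | base (Γ : Ctx S) (St : StoreTy S) (B : S.Base) : Sub Γ St (.base B) (.base B)
  | ref (Γ : Ctx S) (St : StoreTy S) (B : S.Base) : Sub Γ St (.ref B) (.ref B)
  | arr {Γ : Ctx S} {St : StoreTy S} {T U V W : Ty S} {o p q r ε₁ ε₂ : Qual}
      (hdom : Sub Γ St U V) (hdomq : QSub Γ St p o)
      (hcod : Sub ((U, p) :: Γ) St T W) (hcodq : QSub ((U, p) :: Γ) St q r)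
      (heff : QSub ((U, p) :: Γ) St ε₁ ε₂) :
      Sub Γ St (.arr V o ε₁ T q) (.arr U p ε₂ W r)

/-- Subtyping `Γ | Σ ⊢ T₁^p ε₁ <: T₂^q ε₂` of qualified types with effects. -/
def SubQ {S : Sig} (Γ : Ctx S) (St : StoreTy S) (T₁ : Ty S) (p ε₁ : Qual)
    (T₂ : Ty S) (q ε₂ : Qual) : Prop :=
  Sub Γ St T₁ T₂ ∧ QSub Γ St p q ∧ QSub Γ St ε₁ ε₂

/-! ### Term typing -/

/-- `HasType Γ St φ t T q ε` is the judgment `[Γ | Σ]^φ ⊢ t : T^q ε`. In `app` and `letin` the type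
of the result is `shift U`, which expresses that the bound variable is not free in it; hence the
substitution `[p/x]` acts only on the qualifier and the effect. Sequential composition of effects is
their union. In `abs` the assumption `T^p` on the parameter is well-scoped. In `app` the function
and the argument reach only what is observable. -/
inductive HasType {S : Sig} : Ctx S → StoreTy S → Qual → Tm S → Ty S → Qual → Qual → Prop
  | cst {Γ : Ctx S} {St : StoreTy S} {φ : Qual} {c : S.Const} {B : S.Base}
      (hc : S.mem c B) :
      HasType Γ St φ (.cst c) (.base B) ∅ ∅
  | var {Γ : Ctx S} {St : StoreTy S} {φ : Qual} {i : ℕ} {T : Ty S} {q : Qual}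
      (hx : InCtx Γ i T q) (hφ : avar i ∈ φ) :
      HasType Γ St φ (.var i) T {avar i} ∅
  | loc {Γ : Ctx S} {St : StoreTy S} {φ : Qual} {l : Loc} {T : Ty S} {q : Qual}
      (hl : St.lookup l = some (T, q)) (hφ : aloc l ∈ φ) :
      HasType Γ St φ (.loc l) T {aloc l} ∅
  | abs {Γ : Ctx S} {St : StoreTy S} {φ : Qual} {t : Tm S} {T U : Ty S} {p q r ε : Qual}
      (hT : T.Scoped Γ.length St.dom) (hp : p ⊆ domOf Γ St)
      (ht : HasType ((T, p) :: Γ) St q.withVar t U r ε) (hq : q ⊆ φ) :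
      HasType Γ St φ (.lam t) (.arr T p ε U r) q ∅
  | app {Γ : Ctx S} {St : StoreTy S} {φ : Qual} {t₁ t₂ : Tm S} {T U : Ty S}
      {p q r d ε₁ ε₂ ε₃ : Qual}
      (ht₁ : HasType Γ St φ t₁ (.arr T d ε₃ U.shift r) q ε₁)
      (ht₂ : HasType Γ St φ t₂ T p ε₂)
      (hd : (d : Set Atom) = sat Γ St p ∩ sat Γ St q)
      (hp : sat Γ St p ⊆ (φ : Set Atom)) (hq : sat Γ St q ⊆ (φ : Set Atom))
      (hε : ε₃ ⊆ q.withVar) (hr : r ⊆ φ.withVar) :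
      HasType Γ St φ (.app t₁ t₂) U (Qual.inst p r) (ε₁ ∪ ε₂ ∪ Qual.inst p ε₃)
  | letin {Γ : Ctx S} {St : StoreTy S} {φ : Qual} {t₁ t₂ : Tm S} {T U : Ty S}
      {p q d ε₁ ε₂ : Qual}
      (ht₁ : HasType Γ St φ t₁ T p ε₁)
      (hd : (d : Set Atom) = sat Γ St p ∩ sat Γ St φ)
      (ht₂ : HasType ((T, d) :: Γ) St φ.withVar t₂ U.shift q ε₂) :
      HasType Γ St φ (.letin t₁ t₂) U (Qual.inst p q) (ε₁ ∪ Qual.inst p ε₂)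
  | ref {Γ : Ctx S} {St : StoreTy S} {φ : Qual} {t₁ t₂ : Tm S} {B : S.Base} {q ε₁ ε₂ : Qual}
      (ht₁ : HasType Γ St φ t₁ (.base S.allocTy) q ε₁)
      (ht₂ : HasType Γ St φ t₂ (.base B) ∅ ε₂) :
      HasType Γ St φ (.ref t₁ t₂) (.ref B) ∅ (ε₁ ∪ ε₂ ∪ q)
  | deref {Γ : Ctx S} {St : StoreTy S} {φ : Qual} {t : Tm S} {B : S.Base} {q ε : Qual}
      (ht : HasType Γ St φ t (.ref B) q ε) :
      HasType Γ St φ (.deref t) (.base B) ∅ (ε ∪ q)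
  | assign {Γ : Ctx S} {St : StoreTy S} {φ : Qual} {t₁ t₂ : Tm S} {B : S.Base} {q ε₁ ε₂ : Qual}
      (ht₁ : HasType Γ St φ t₁ (.ref B) q ε₁)
      (ht₂ : HasType Γ St φ t₂ (.base B) ∅ ε₂) :
      HasType Γ St φ (.assign t₁ t₂) (.base S.unitTy) ∅ (ε₁ ∪ ε₂ ∪ q)
  | sub {Γ : Ctx S} {St : StoreTy S} {φ : Qual} {t : Tm S} {T U : Ty S} {p q ε₁ ε₂ : Qual}
      (ht : HasType Γ St φ t T p ε₁)
      (hs : SubQ Γ St T p ε₁ U q ε₂) (hq : q ⊆ φ) (hε : ε₂ ⊆ φ) :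
      HasType Γ St φ t U q ε₂

/-! ### Stores and reduction -/

/-- What a store binds to a location: the allocation capability `ω`, or a cell `ref_ω v`. -/
inductive Entry (S : Sig) : Type where
  | cap : Entry S
  | cell (v : Tm S) : Entry S

/-- Stores: sequences of bindings `let ℓ = ω` and `let ℓ = ref_ω v`, oldest first. -/
abbrev Store (S : Sig) := List (Loc × Entry S)

/-- `dom(σ)`. -/
def Store.dom {S : Sig} (σ : Store S) : List Loc := σ.map Prod.fst

/-- Well-formed stores `[Γ | Σ]^φ ⊢ σ`. A store is built by allocations, from the empty store or
from an initial store, which binds one location `w : Alloc^∅` to the capability `ω`. -/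
inductive WfStore {S : Sig} (Γ : Ctx S) (φ : Qual) : StoreTy S → Store S → Prop
  | empty : WfStore Γ φ ∅ []
  | init (w : Loc) :
      WfStore Γ φ (Finmap.singleton w (Ty.base S.allocTy, ∅)) [(w, .cap)]
  | alloc {St : StoreTy S} {σ : Store S} {v : Tm S} {B : S.Base} {l : Loc}
      (hσ : WfStore Γ φ St σ) (hval : v.IsValue)
      (hv : HasType Γ St φ v (.base B) ∅ ∅) (hl : l ∉ St.dom) :
      WfStore Γ φ (St.insert l (Ty.ref B, ∅)) (σ ++ [(l, .cell v)])

/-- Call-by-value evaluation contexts. -/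
inductive ECtx (S : Sig) : Type where
  | hole : ECtx S
  | appL (E : ECtx S) (t : Tm S) : ECtx S
  | appR (v : Tm S) (hv : v.IsValue) (E : ECtx S) : ECtx S
  | refL (E : ECtx S) (t : Tm S) : ECtx S
  | refR (v : Tm S) (hv : v.IsValue) (E : ECtx S) : ECtx S
  | deref (E : ECtx S) : ECtx S
  | assignL (E : ECtx S) (t : Tm S) : ECtx S
  | assignR (v : Tm S) (hv : v.IsValue) (E : ECtx S) : ECtx S
  | letin (E : ECtx S) (t : Tm S) : ECtx S

/-- `E[t]`. -/
def ECtx.plug {S : Sig} : ECtx S → Tm S → Tm S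
  | .hole, u => u
  | .appL E t, u => .app (E.plug u) t
  | .appR v _ E, u => .app v (E.plug u)
  | .refL E t, u => .ref (E.plug u) t
  | .refR v _ E, u => .ref v (E.plug u)
  | .deref E, u => .deref (E.plug u)
  | .assignL E t, u => .assign (E.plug u) t
  | .assignR v _ E, u => .assign v (E.plug u)
  | .letin E t, u => .letin (E.plug u) t

/-- The values that act as the allocation capability in a store: the constant `ω`, and every
location that the store binds to `ω`. -/
inductive IsCap {S : Sig} (σ : Store S) : Tm S → Prop
  | omega : IsCap σ (.cst S.omega)
  | loc {w : Loc} (h : (w, Entry.cap) ∈ σ) : IsCap σ (.loc w)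

/-- Single-step call-by-value reduction: `Step σ t σ' t'` is `σ | t ⟶ σ' | t'`. -/
inductive Step {S : Sig} : Store S → Tm S → Store S → Tm S → Prop
  | beta (σ : Store S) (E : ECtx S) (t v : Tm S) (hv : v.IsValue) :
      Step σ (E.plug (.app (.lam t) v)) σ (E.plug (Tm.inst v t))
  | letin (σ : Store S) (E : ECtx S) (v t : Tm S) (hv : v.IsValue) :
      Step σ (E.plug (.letin v t)) σ (E.plug (Tm.inst v t))
  | ref (σ : Store S) (E : ECtx S) (a v : Tm S) (l : Loc) (ha : IsCap σ a) (hv : v.IsValue)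
      (hl : l ∉ σ.dom) :
      Step σ (E.plug (.ref a v)) (σ ++ [(l, .cell v)]) (E.plug (.loc l))
  | deref (σ₁ σ₂ : Store S) (E : ECtx S) (l : Loc) (v : Tm S) :
      Step (σ₁ ++ (l, .cell v) :: σ₂) (E.plug (.deref (.loc l)))
        (σ₁ ++ (l, .cell v) :: σ₂) (E.plug v)
  | assign (σ₁ σ₂ : Store S) (E : ECtx S) (l : Loc) (v v' : Tm S) (hv' : v'.IsValue) :
      Step (σ₁ ++ (l, .cell v) :: σ₂) (E.plug (.assign (.loc l) v'))
        (σ₁ ++ (l, .cell v') :: σ₂) (E.plug (.cst S.unit))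

end LambdaStar

namespace LambdaStar

/-! ### Simultaneous substitution of qualifiers for variables -/

/-! Separation survives because qualifiers grow only by fresh locations. The sharp form of
preservation is `Step.preservation`: one step extends the store typing by a set `F` of new locations
of reference type, and the reduct has the old type with qualifier `q ∪ F`. The first step adds
locations outside the original store typing, hence outside `q₂`. The second adds locations outside
the extended one, hence outside `q₁ ∪ F₁`. So the two grown qualifiers are still disjoint.

A well-formed store has a `Flat` typing and its cells hold constants (`WfStore.consistent`).
Locations therefore reach nothing, a closed qualifier is its own saturation
(`StoreTy.Flat.sat_nil`), and the separation condition of application becomes a plain intersection.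
The contractions of functions and lets rest on the substitution lemma `HasType.subst`. Its
hypothesis `Compat` says that the images of two observable atoms overlap only in the image of
something reachable from both; this carries the condition on `p* ∩ q*` across the substitution.

`HasType.replaceable` passes the growth of a redex through its evaluation context. Two frames
resist. Under a let, the body must be retyped with a variable that now also reaches `F`;
`HasType.grow` treats this as a substitution that sends the variable `x` to `{x} ∪ F`. A term that
is to be stored must keep the empty qualifier although its redex has grown; `HasType.restrict_base`
repairs this by showing that a closed term of base type never needs locations of reference type in
its qualifier. -/

/-- The image of an atom under the substitution `θ` of qualifiers for variables. -/
def Qual.substAtom (θ : ℕ → Qual) : Atom → Qual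
  | Sum.inl i => θ i
  | Sum.inr l => {aloc l}

/-- Simultaneous substitution of qualifiers for the variables of a qualifier. -/
def Qual.subst (θ : ℕ → Qual) (q : Qual) : Qual := q.biUnion (Qual.substAtom θ)

/-- Weaken an atom by one (innermost) variable. -/
def shiftAtom : Atom → Atom := Sum.map Nat.succ id

/-- Extend a qualifier substitution under one binder. -/
def liftQ (θ : ℕ → Qual) : ℕ → Qual
  | 0 => {avar 0}
  | i + 1 => Qual.shift (θ i)

/-- The substitution of `p` for the innermost variable. -/
def instQ (p : Qual) : ℕ → Qual
  | 0 => p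
  | i + 1 => {avar i}

/-- The qualifier substitution of a renaming of variables. -/
def renQ (ρ : ℕ → ℕ) : ℕ → Qual := fun i => {avar (ρ i)}

namespace Qual

@[simp] theorem substAtom_inl (θ : ℕ → Qual) (i : ℕ) : substAtom θ (Sum.inl i) = θ i := rfl
@[simp] theorem substAtom_inr (θ : ℕ → Qual) (l : ℕ) : substAtom θ (Sum.inr l) = {aloc l} := rfl

theorem mem_subst {θ : ℕ → Qual} {q : Qual} {a : Atom} :
    a ∈ subst θ q ↔ ∃ b ∈ q, a ∈ substAtom θ b := by
  simp [subst]

theorem mem_shift {q : Qual} {a : Atom} : a ∈ shift q ↔ ∃ b ∈ q, shiftAtom b = a := by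
  simp only [shift, rename, shiftAtom, Finset.mem_image]

theorem shiftAtom_injective : Function.Injective shiftAtom :=
  Sum.map_injective.2 ⟨Nat.succ_injective, Function.injective_id⟩

@[simp] theorem shiftAtom_inj {a b : Atom} : shiftAtom a = shiftAtom b ↔ a = b :=
  shiftAtom_injective.eq_iff

@[simp] theorem shiftAtom_mem_shift {q : Qual} {a : Atom} : shiftAtom a ∈ shift q ↔ a ∈ q := by
  simp [mem_shift]

theorem shiftAtom_ne_zero (a : Atom) : shiftAtom a ≠ avar 0 := by
  rcases a with i | l <;> simp [shiftAtom]

@[simp] theorem zero_notMem_shift {q : Qual} : avar 0 ∉ shift q := by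
  simp only [mem_shift, not_exists, not_and]
  exact fun a _ => shiftAtom_ne_zero a

theorem atom_cases (a : Atom) : a = avar 0 ∨ ∃ b, a = shiftAtom b := by
  rcases a with (_ | i) | l
  · exact .inl rfl
  · exact .inr ⟨Sum.inl i, rfl⟩
  · exact .inr ⟨Sum.inr l, rfl⟩

theorem mem_withVar {q : Qual} {a : Atom} :
    a ∈ withVar q ↔ a = avar 0 ∨ ∃ b ∈ q, shiftAtom b = a := by
  simp [withVar, mem_shift]

@[simp] theorem shiftAtom_mem_withVar {q : Qual} {a : Atom} :
    shiftAtom a ∈ withVar q ↔ a ∈ q := by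
  simp [mem_withVar, shiftAtom_ne_zero]

@[simp] theorem zero_mem_withVar {q : Qual} : avar 0 ∈ withVar q := by simp [mem_withVar]

theorem withVar_mono {p q : Qual} (h : p ⊆ q) : withVar p ⊆ withVar q := by
  intro a ha
  rw [mem_withVar] at ha ⊢
  exact ha.imp_right fun ⟨b, hb, e⟩ => ⟨b, h hb, e⟩

theorem shift_mono {p q : Qual} (h : p ⊆ q) : shift p ⊆ shift q := Finset.image_subset_image h

theorem subst_mono (θ : ℕ → Qual) {p q : Qual} (h : p ⊆ q) : subst θ p ⊆ subst θ q :=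
  Finset.biUnion_subset_biUnion_of_subset_left _ h

theorem subst_union (θ : ℕ → Qual) (p q : Qual) : subst θ (p ∪ q) = subst θ p ∪ subst θ q :=
  Finset.union_biUnion ..

@[simp] theorem subst_singleton (θ : ℕ → Qual) (a : Atom) : subst θ {a} = substAtom θ a :=
  Finset.singleton_biUnion ..

theorem substAtom_subset_subst {θ : ℕ → Qual} {q : Qual} {a : Atom} (h : a ∈ q) :
    substAtom θ a ⊆ subst θ q := Finset.subset_biUnion_of_mem _ h

theorem subst_congr {θ τ : ℕ → Qual} (h : ∀ i, θ i = τ i) (q : Qual) : subst θ q = subst τ q := by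
  rw [funext h]

theorem rename_eq_subst (ρ : ℕ → ℕ) (q : Qual) : rename ρ q = subst (renQ ρ) q := by
  ext a
  simp only [rename, Finset.mem_image, mem_subst]
  refine exists_congr fun b => and_congr_right fun _ => ?_
  rcases b with i | l <;> simp [renQ, eq_comm]

theorem shift_eq_subst (q : Qual) : shift q = subst (renQ Nat.succ) q := rename_eq_subst _ _

theorem inst_eq_subst (p q : Qual) : inst p q = subst (instQ p) q := by
  unfold inst subst
  congr 1
  funext a
  rcases a with (_ | i) | l <;> rfl

theorem subst_subst (τ θ : ℕ → Qual) (q : Qual) :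
    subst τ (subst θ q) = subst (fun i => subst τ (θ i)) q := by
  unfold subst
  rw [Finset.biUnion_biUnion]
  congr 1
  funext a
  rcases a with i | l
  · rfl
  · simp

theorem subst_renQ_id (q : Qual) : subst (renQ id) q = q := by
  rw [← rename_eq_subst]
  simp [rename]

theorem substAtom_liftQ_shiftAtom (θ : ℕ → Qual) (a : Atom) :
    substAtom (liftQ θ) (shiftAtom a) = shift (substAtom θ a) := by
  rcases a with i | l
  · rfl
  · ext b; simp [mem_shift, shiftAtom, eq_comm]

@[simp] theorem substAtom_liftQ_zero (θ : ℕ → Qual) : substAtom (liftQ θ) (avar 0) = {avar 0} := rfl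

theorem subst_liftQ_shift (θ : ℕ → Qual) (q : Qual) :
    subst (liftQ θ) (shift q) = shift (subst θ q) := by
  rw [shift_eq_subst, shift_eq_subst, subst_subst, subst_subst]
  refine subst_congr (fun i => ?_) _
  simp [renQ, liftQ, shift_eq_subst]

theorem subst_liftQ_withVar (θ : ℕ → Qual) (q : Qual) :
    subst (liftQ θ) (withVar q) = withVar (subst θ q) := by
  rw [withVar, Finset.insert_eq, subst_union, subst_liftQ_shift]
  rfl

theorem subst_inst (θ : ℕ → Qual) (p q : Qual) :
    subst θ (inst p q) = inst (subst θ p) (subst (liftQ θ) q) := by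
  rw [inst_eq_subst, inst_eq_subst, subst_subst, subst_subst]
  refine subst_congr (fun i => ?_) _
  cases i with
  | zero => simp [instQ, liftQ]
  | succ i =>
    simp only [instQ, liftQ, shift_eq_subst, subst_subst, subst_singleton, substAtom_inl]
    -- With an identity substitution inserted on the left, both sides are substitutions into `θ i`
    -- and can be compared variable by variable.
    conv_lhs => rw [← subst_renQ_id (θ i)]
    refine subst_congr (fun j => ?_) _
    simp [renQ, instQ]

theorem inst_mono {p p' q q' : Qual} (hp : p ⊆ p') (hq : q ⊆ q') : inst p q ⊆ inst p' q' := by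
  refine Finset.biUnion_subset_biUnion_of_subset_left _ hq |>.trans ?_
  refine Finset.biUnion_mono fun a _ => ?_
  rcases a with (_ | i) | l
  · exact hp
  · exact subset_rfl
  · exact subset_rfl

theorem mem_inst {p q : Qual} {a : Atom} :
    a ∈ inst p q ↔ (a ∈ p ∧ avar 0 ∈ q) ∨ shiftAtom a ∈ q := by
  simp only [inst, Finset.mem_biUnion]
  constructor
  · rintro ⟨(_ | i) | l, hb, h⟩
    · exact .inl ⟨h, hb⟩
    · rw [instAtom, Finset.mem_singleton] at h; subst h; exact .inr hb
    · rw [instAtom, Finset.mem_singleton] at h; subst h; exact .inr hb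
  · rintro (⟨h, hb⟩ | h)
    · exact ⟨_, hb, h⟩
    · refine ⟨_, h, ?_⟩
      rcases a with i | l <;> simp [instAtom, shiftAtom]

theorem inst_subset {p q φ : Qual} (hp : p ⊆ φ) (hq : q ⊆ withVar φ) : inst p q ⊆ φ := by
  intro a ha
  rcases mem_inst.1 ha with h | h
  · exact hp h.1
  · exact shiftAtom_mem_withVar.1 (hq h)

end Qual

theorem liftQ_renQ (ρ : ℕ → ℕ) : liftQ (renQ ρ) = renQ (liftRen ρ) := by
  funext i
  cases i with
  | zero => rfl
  | succ i => simp [liftQ, renQ, liftRen, Qual.shift, Qual.rename]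

theorem liftQ_comp (τ θ : ℕ → Qual) :
    (fun i => Qual.subst (liftQ τ) (liftQ θ i)) = liftQ fun i => Qual.subst τ (θ i) := by
  funext i
  cases i with
  | zero => rfl
  | succ i => exact Qual.subst_liftQ_shift τ (θ i)

namespace Ty

variable {S : Sig}

/-- Simultaneous substitution of qualifiers for the variables of a type. -/
def subst : (ℕ → Qual) → Ty S → Ty S
  | _, base B => base B
  | _, ref B => ref B
  | θ, arr T p ε U r =>
      arr (subst θ T) (Qual.subst θ p) (Qual.subst (liftQ θ) ε)
        (subst (liftQ θ) U) (Qual.subst (liftQ θ) r)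

theorem rename_eq_subst (ρ : ℕ → ℕ) (T : Ty S) : rename ρ T = subst (renQ ρ) T := by
  induction T generalizing ρ with
  | base B => rfl
  | ref B => rfl
  | arr T p ε U r ihT ihU =>
    simp only [rename, subst, ihT, ihU, Qual.rename_eq_subst, liftQ_renQ]

theorem shift_eq_subst (T : Ty S) : shift T = subst (renQ Nat.succ) T := rename_eq_subst _ _

theorem subst_subst (τ θ : ℕ → Qual) (T : Ty S) :
    subst τ (subst θ T) = subst (fun i => Qual.subst τ (θ i)) T := by
  induction T generalizing τ θ with
  | base B => rfl
  | ref B => rfl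
  | arr T p ε U r ihT ihU => simp only [subst, ihT, ihU, Qual.subst_subst, liftQ_comp]

theorem subst_renQ_id (T : Ty S) : subst (renQ id) T = T := by
  induction T with
  | base B => rfl
  | ref B => rfl
  | arr T p ε U r ihT ihU =>
    have h : liftRen id = id := by funext i; cases i <;> rfl
    simp only [subst, liftQ_renQ, h, ihT, ihU, Qual.subst_renQ_id]

theorem subst_shift (θ : ℕ → Qual) (T : Ty S) : subst θ (shift T) = subst (fun i => θ (i + 1)) T := by
  rw [shift_eq_subst, subst_subst]
  congr 1
  funext i
  simp [renQ]

theorem subst_liftQ_shift (θ : ℕ → Qual) (T : Ty S) :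
    subst (liftQ θ) (shift T) = shift (subst θ T) := by
  rw [subst_shift, shift_eq_subst, subst_subst]
  congr 1
  funext i
  exact Qual.shift_eq_subst _

/-- The bound variable is not free in the result type of an application or a let, so contraction
leaves that type alone. -/
theorem subst_instQ_shift (p : Qual) (T : Ty S) : subst (instQ p) (shift T) = T := by
  rw [subst_shift]
  exact subst_renQ_id T

end Ty

/-! ### Scoping -/

theorem mem_domAtoms {n : ℕ} {D : Finset Loc} {a : Atom} :
    a ∈ domAtoms n D ↔ (∃ i < n, a = avar i) ∨ ∃ l ∈ D, a = aloc l := by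
  simp [domAtoms, eq_comm]

@[simp] theorem avar_mem_domAtoms {n : ℕ} {D : Finset Loc} {i : ℕ} :
    avar i ∈ domAtoms n D ↔ i < n := by
  simp [mem_domAtoms]

@[simp] theorem aloc_mem_domAtoms {n : ℕ} {D : Finset Loc} {l : Loc} :
    aloc l ∈ domAtoms n D ↔ l ∈ D := by
  simp [mem_domAtoms]

@[simp] theorem shiftAtom_mem_domAtoms {n : ℕ} {D : Finset Loc} {a : Atom} :
    shiftAtom a ∈ domAtoms (n + 1) D ↔ a ∈ domAtoms n D := by
  rcases a with i | l
  · exact avar_mem_domAtoms.trans (by simp)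
  · exact aloc_mem_domAtoms.trans aloc_mem_domAtoms.symm

theorem shift_subset_domAtoms {n : ℕ} {D : Finset Loc} {q : Qual} (h : q ⊆ domAtoms n D) :
    Qual.shift q ⊆ domAtoms (n + 1) D := by
  intro a ha
  obtain ⟨b, hb, rfl⟩ := Qual.mem_shift.1 ha
  exact shiftAtom_mem_domAtoms.2 (h hb)

theorem withVar_domAtoms (n : ℕ) (D : Finset Loc) :
    Qual.withVar (domAtoms n D) = domAtoms (n + 1) D := by
  ext a
  rcases Qual.atom_cases a with rfl | ⟨b, rfl⟩ <;> simp

theorem withVar_subset_domAtoms {n : ℕ} {D : Finset Loc} {q : Qual} (h : q ⊆ domAtoms n D) :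
    Qual.withVar q ⊆ domAtoms (n + 1) D :=
  withVar_domAtoms n D ▸ Qual.withVar_mono h

/-- The qualifier substitution `θ` maps atoms in scope of `n`, `D` to qualifiers in scope of
`m`, `D'`. -/
def ScopedQ (θ : ℕ → Qual) (n : ℕ) (D : Finset Loc) (m : ℕ) (D' : Finset Loc) : Prop :=
  (∀ i < n, θ i ⊆ domAtoms m D') ∧ D ⊆ D'

namespace ScopedQ

variable {θ : ℕ → Qual} {n m : ℕ} {D D' : Finset Loc}

theorem subst_subset (h : ScopedQ θ n D m D') {q : Qual} (hq : q ⊆ domAtoms n D) :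
    Qual.subst θ q ⊆ domAtoms m D' := by
  intro a ha
  obtain ⟨b, hb, hab⟩ := Qual.mem_subst.1 ha
  rcases b with i | l
  · exact h.1 i (avar_mem_domAtoms.1 (hq hb)) hab
  · rw [Qual.substAtom_inr, Finset.mem_singleton] at hab
    subst hab
    exact aloc_mem_domAtoms.2 (h.2 (aloc_mem_domAtoms.1 (hq hb)))

theorem lift (h : ScopedQ θ n D m D') : ScopedQ (liftQ θ) (n + 1) D (m + 1) D' := by
  refine ⟨fun i hi => ?_, h.2⟩
  cases i with
  | zero => simp [liftQ]
  | succ i => exact shift_subset_domAtoms (h.1 i (by omega))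

theorem ty_subst {S : Sig} {T : Ty S} (h : ScopedQ θ n D m D') (hT : T.Scoped n D) :
    (T.subst θ).Scoped m D' := by
  induction T generalizing θ n m with
  | base B => trivial
  | ref B => trivial
  | arr T p ε U r ihT ihU =>
    obtain ⟨h1, h2, h3, h4, h5⟩ := hT
    exact ⟨ihT h h1, h.subst_subset h2, h.lift.subst_subset h3, ihU h.lift h4,
      h.lift.subst_subset h5⟩

end ScopedQ

theorem scopedQ_succ (n : ℕ) (D : Finset Loc) : ScopedQ (renQ Nat.succ) n D (n + 1) D := by
  refine ⟨fun i hi => ?_, subset_rfl⟩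
  simp only [renQ, Finset.singleton_subset_iff, avar_mem_domAtoms]
  omega

theorem Ty.Scoped.shift {S : Sig} {T : Ty S} {n : ℕ} {D : Finset Loc} (h : T.Scoped n D) :
    T.shift.Scoped (n + 1) D := by
  rw [Ty.shift_eq_subst]
  exact (scopedQ_succ n D).ty_subst h

theorem subset_domAtoms_of_rename {ρ : ℕ → ℕ} {n m : ℕ} {D : Finset Loc}
    (h : ∀ i, ρ i < m → i < n) {q : Qual} (hq : Qual.rename ρ q ⊆ domAtoms m D) :
    q ⊆ domAtoms n D := by
  intro a ha
  have := hq (Finset.mem_image_of_mem (Sum.map ρ id) ha)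
  rcases a with i | l
  · exact avar_mem_domAtoms.2 (h i (avar_mem_domAtoms.1 this))
  · exact aloc_mem_domAtoms.2 (aloc_mem_domAtoms.1 this)

/-- Result types occur weakened in the rules for application and let; reflecting scope along a
renaming recovers their scoping outside the binder. -/
theorem Ty.Scoped.of_rename {S : Sig} {T : Ty S} {ρ : ℕ → ℕ} {n m : ℕ} {D : Finset Loc}
    (h : ∀ i, ρ i < m → i < n) (hT : (T.rename ρ).Scoped m D) : T.Scoped n D := by
  induction T generalizing ρ n m with
  | base B => trivial
  | ref B => trivial
  | arr T p ε U r ihT ihU =>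
    obtain ⟨h1, h2, h3, h4, h5⟩ := hT
    have h' : ∀ i, liftRen ρ i < m + 1 → i < n + 1 := by
      intro i hi
      cases i with
      | zero => omega
      | succ i => exact Nat.succ_lt_succ (h i (Nat.lt_of_succ_lt_succ hi))
    exact ⟨ihT h h1, subset_domAtoms_of_rename h h2, subset_domAtoms_of_rename h' h3,
      ihU h' h4, subset_domAtoms_of_rename h' h5⟩

theorem Ty.Scoped.of_shift {S : Sig} {T : Ty S} {n : ℕ} {D : Finset Loc}
    (hT : T.shift.Scoped (n + 1) D) : T.Scoped n D :=
  hT.of_rename fun _ h => Nat.lt_of_succ_lt_succ h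

variable {S : Sig}

/-! ### Regularity of typing -/

/-- Every entry of the store typing has an empty qualifier and a base or reference type. -/
def StoreTy.Flat (St : StoreTy S) : Prop :=
  ∀ (l : Loc) (T : Ty S) (q : Qual), St.lookup l = some (T, q) →
    q = ∅ ∧ ((∃ B, T = .base B) ∨ ∃ B, T = .ref B)

theorem StoreTy.Flat.wellScoped {St : StoreTy S} (h : St.Flat) : St.WellScoped := by
  intro l T q hl
  obtain ⟨rfl, ⟨B, rfl⟩ | ⟨B, rfl⟩⟩ := h l T q hl <;> exact ⟨trivial, Finset.empty_subset _⟩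

theorem StoreTy.Flat.subst_eq {St : StoreTy S} (h : St.Flat) {l : Loc} {T : Ty S} {q : Qual}
    (hl : St.lookup l = some (T, q)) (θ : ℕ → Qual) : T.subst θ = T := by
  obtain ⟨-, ⟨B, rfl⟩ | ⟨B, rfl⟩⟩ := h l T q hl <;> rfl

theorem StoreTy.Flat.scoped {St : StoreTy S} (h : St.Flat) {l : Loc} {T : Ty S} {q : Qual}
    (hl : St.lookup l = some (T, q)) (n : ℕ) (D : Finset Loc) : T.Scoped n D := by
  obtain ⟨-, ⟨B, rfl⟩ | ⟨B, rfl⟩⟩ := h l T q hl <;> trivial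

theorem StoreTy.mem_dom {St : StoreTy S} {l : Loc} : l ∈ St.dom ↔ ∃ b, St.lookup l = some b := by
  rw [StoreTy.dom, Finmap.mem_keys, ← Finmap.lookup_isSome, Option.isSome_iff_exists]

theorem StoreTy.Extends.dom_subset {St St' : StoreTy S} (h : St'.Extends St) :
    St.dom ⊆ St'.dom := by
  intro l hl
  obtain ⟨b, hb⟩ := StoreTy.mem_dom.1 hl
  exact StoreTy.mem_dom.2 ⟨b, h l b hb⟩

theorem StoreTy.Extends.refl (St : StoreTy S) : St.Extends St := fun _ _ h => h

theorem StoreTy.obs_eq_domAtoms (St : StoreTy S) : St.obs = domAtoms 0 St.dom := by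
  simp [StoreTy.obs, domAtoms]

/-- Every entry of the context is in scope. -/
def ScopedCtx (Γ : Ctx S) (St : StoreTy S) : Prop :=
  ∀ (i : ℕ) (T : Ty S) (q : Qual), InCtx Γ i T q → T.Scoped Γ.length St.dom ∧ q ⊆ domOf Γ St

theorem scopedCtx_nil (St : StoreTy S) : ScopedCtx [] St := fun _ _ _ h => by cases h

theorem ScopedCtx.cons {Γ : Ctx S} {St : StoreTy S} {T : Ty S} {q : Qual} (h : ScopedCtx Γ St)
    (hT : T.Scoped Γ.length St.dom) (hq : q ⊆ domOf Γ St) : ScopedCtx ((T, q) :: Γ) St := by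
  intro i U r hi
  cases hi with
  | zero => exact ⟨hT.shift, shift_subset_domAtoms hq⟩
  | succ _ hi =>
    obtain ⟨h1, h2⟩ := h _ _ _ hi
    exact ⟨h1.shift, shift_subset_domAtoms h2⟩

theorem InCtx.lt_length {Γ : Ctx S} {i : ℕ} {T : Ty S} {q : Qual} (h : InCtx Γ i T q) :
    i < Γ.length := by
  induction h with
  | zero => simp
  | succ _ _ ih => simpa using ih

theorem withVar_subset_domOf {Γ : Ctx S} {St : StoreTy S} {b : Ty S × Qual} {q : Qual}
    (h : q ⊆ domOf Γ St) : q.withVar ⊆ domOf (b :: Γ) St :=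
  withVar_subset_domAtoms h

theorem Reach.mem_domOf {Γ : Ctx S} {St : StoreTy S} (hΓ : ScopedCtx Γ St) (hSt : St.Flat)
    {a b : Atom} (h : Reach Γ St a b) : b ∈ domOf Γ St := by
  cases h with
  | var h hb => exact (hΓ _ _ _ h).2 hb
  | loc h hb => rw [(hSt _ _ _ h).1] at hb; simp at hb

theorem subset_sat (Γ : Ctx S) (St : StoreTy S) (q : Qual) : (q : Set Atom) ⊆ sat Γ St q :=
  fun a ha => ⟨a, ha, .refl⟩

theorem sat_mono (Γ : Ctx S) (St : StoreTy S) {p q : Qual} (h : p ⊆ q) :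
    sat Γ St p ⊆ sat Γ St q :=
  fun _ ⟨b, hb, hr⟩ => ⟨b, h hb, hr⟩

theorem sat_subset_domOf {Γ : Ctx S} {St : StoreTy S} (hΓ : ScopedCtx Γ St) (hSt : St.Flat)
    {q : Qual} (hq : q ⊆ domOf Γ St) : sat Γ St q ⊆ (domOf Γ St : Set Atom) := by
  rintro a ⟨b, hb, hr⟩
  induction hr with
  | refl => exact hq hb
  | tail _ h _ => exact h.mem_domOf hΓ hSt

theorem exists_coe_eq_of_subset {A : Set Atom} {q : Qual} (h : A ⊆ q) :
    ∃ d : Qual, (d : Set Atom) = A :=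
  ⟨_, (q.finite_toSet.subset h).coe_toFinset⟩

/-- Each rule either produces observable atoms or checks for them. For application the side
conditions on the latent effect and on the result qualifier do this; for let, the observation of the
body does. -/
theorem HasType.subset_obs {Γ : Ctx S} {St : StoreTy S} {φ : Qual} {t : Tm S} {T : Ty S}
    {q ε : Qual} (h : HasType Γ St φ t T q ε) : q ⊆ φ ∧ ε ⊆ φ := by
  induction h with
  | cst => exact ⟨Finset.empty_subset _, Finset.empty_subset _⟩
  | var _ h => exact ⟨Finset.singleton_subset_iff.2 h, Finset.empty_subset _⟩
  | loc _ h => exact ⟨Finset.singleton_subset_iff.2 h, Finset.empty_subset _⟩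
  | abs _ _ _ hq => exact ⟨hq, Finset.empty_subset _⟩
  | app _ _ _ _ _ hε hr ih₁ ih₂ =>
    exact ⟨Qual.inst_subset ih₂.1 hr, Finset.union_subset (Finset.union_subset ih₁.2 ih₂.2)
      (Qual.inst_subset ih₂.1 (hε.trans (Qual.withVar_mono ih₁.1)))⟩
  | letin _ _ _ ih₁ ih₂ =>
    exact ⟨Qual.inst_subset ih₁.1 ih₂.1,
      Finset.union_subset ih₁.2 (Qual.inst_subset ih₁.1 ih₂.2)⟩
  | ref _ _ ih₁ ih₂ =>
    exact ⟨Finset.empty_subset _, Finset.union_subset (Finset.union_subset ih₁.2 ih₂.2) ih₁.1⟩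
  | deref _ ih => exact ⟨Finset.empty_subset _, Finset.union_subset ih.2 ih.1⟩
  | assign _ _ ih₁ ih₂ =>
    exact ⟨Finset.empty_subset _, Finset.union_subset (Finset.union_subset ih₁.2 ih₂.2) ih₁.1⟩
  | sub _ _ hq hε => exact ⟨hq, hε⟩

theorem Sub.refl {Γ : Ctx S} {St : StoreTy S} {T : Ty S} (h : T.Scoped Γ.length St.dom) :
    Sub Γ St T T := by
  induction T generalizing Γ with
  | base B => exact .base ..
  | ref B => exact .ref ..
  | arr T p ε U r ihT ihU =>
    obtain ⟨h1, h2, h3, h4, h5⟩ := h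
    exact .arr (ihT h1) ⟨subset_rfl, h2⟩ (ihU h4) ⟨subset_rfl, h5⟩ ⟨subset_rfl, h3⟩

/-- An equivalence is needed because the domain of a function type is contravariant: the induction
uses both directions. -/
theorem Sub.scoped_iff {Γ : Ctx S} {St : StoreTy S} {T U : Ty S} (h : Sub Γ St T U) :
    T.Scoped Γ.length St.dom ↔ U.Scoped Γ.length St.dom := by
  induction h with
  | base => rfl
  | ref => rfl
  | arr hdom hp hcod hq hε ih₁ ih₂ =>
    exact ⟨fun ⟨h1, _, _, h4, _⟩ => ⟨ih₁.2 h1, hp.1.trans hp.2, hε.2, ih₂.1 h4, hq.2⟩,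
      fun ⟨h1, _, _, h4, _⟩ => ⟨ih₁.1 h1, hp.2, hε.1.trans hε.2, ih₂.2 h4, hq.1.trans hq.2⟩⟩

theorem HasType.sat_subset_sat {Γ : Ctx S} {St : StoreTy S} {φ : Qual} {t : Tm S} {T : Ty S}
    {q ε : Qual} (h : HasType Γ St φ t T q ε) : sat Γ St q ⊆ sat Γ St φ :=
  sat_mono _ _ h.subset_obs.1

/-- Reflexivity of subtyping holds only for scoped types, so every use of subsumption that merely
enlarges a qualifier depends on this. -/
theorem HasType.scoped {Γ : Ctx S} {St : StoreTy S} {φ : Qual} {t : Tm S} {T : Ty S}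
    {q ε : Qual} (h : HasType Γ St φ t T q ε) (hSt : St.Flat) (hΓ : ScopedCtx Γ St)
    (hφ : φ ⊆ domOf Γ St) : T.Scoped Γ.length St.dom := by
  induction h with
  | cst => trivial
  | var h _ => exact (hΓ _ _ _ h).1
  | loc h _ => exact hSt.scoped h _ _
  | abs hT hp ht hq ih =>
    have hq' := withVar_subset_domAtoms (hq.trans hφ)
    exact ⟨hT, hp, ht.subset_obs.2.trans hq', ih hSt (hΓ.cons hT hp) hq',
      ht.subset_obs.1.trans hq'⟩
  | app _ _ _ _ _ _ _ ih₁ _ => exact (ih₁ hSt hΓ hφ).2.2.2.1.of_shift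
  | letin ht₁ hd ht₂ ih₁ ih₂ =>
    refine (ih₂ hSt (hΓ.cons (ih₁ hSt hΓ hφ) ?_) (withVar_subset_domOf hφ)).of_shift
    rw [← Finset.coe_subset, hd]
    exact Set.inter_subset_left.trans
      (sat_subset_domOf hΓ hSt (ht₁.subset_obs.1.trans hφ))
  | ref => trivial
  | deref => trivial
  | assign => trivial
  | sub _ hs _ _ ih => exact hs.1.scoped_iff.1 (ih hSt hΓ hφ)

/-! ### Admissible rules -/

theorem HasType.weaken_qual {Γ : Ctx S} {St : StoreTy S} {φ : Qual} {t : Tm S} {T : Ty S}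
    {q q' ε ε' : Qual} (h : HasType Γ St φ t T q ε) (hSt : St.Flat) (hΓ : ScopedCtx Γ St)
    (hφ : φ ⊆ domOf Γ St) (hq : q ⊆ q') (hq' : q' ⊆ φ) (hε : ε ⊆ ε') (hε' : ε' ⊆ φ) :
    HasType Γ St φ t T q' ε' :=
  h.sub ⟨.refl (h.scoped hSt hΓ hφ), ⟨hq, hq'.trans hφ⟩, ⟨hε, hε'.trans hφ⟩⟩ hq' hε'

/-- Application of a function whose domain is at most as separated from the function as
required. -/
theorem HasType.app_of_subset {Γ : Ctx S} {St : StoreTy S} {φ : Qual} {t₁ t₂ : Tm S} {T U : Ty S}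
    {p q r d ε₁ ε₂ ε₃ q' ε' : Qual} (hSt : St.Flat) (hΓ : ScopedCtx Γ St) (hφ : φ ⊆ domOf Γ St)
    (ht₁ : HasType Γ St φ t₁ (.arr T d ε₃ U.shift r) q ε₁)
    (ht₂ : HasType Γ St φ t₂ T p ε₂)
    (hd : sat Γ St p ∩ sat Γ St q ⊆ (d : Set Atom))
    (hp : sat Γ St p ⊆ (φ : Set Atom)) (hq : sat Γ St q ⊆ (φ : Set Atom))
    (hε : ε₃ ⊆ q.withVar) (hr : r ⊆ φ.withVar)
    (hq' : Qual.inst p r ⊆ q') (hqφ : q' ⊆ φ)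
    (hε' : ε₁ ∪ ε₂ ∪ Qual.inst p ε₃ ⊆ ε') (hεφ : ε' ⊆ φ) :
    HasType Γ St φ (.app t₁ t₂) U q' ε' := by
  obtain ⟨d', hd'⟩ := exists_coe_eq_of_subset hd
  obtain ⟨h1, h2, h3, h4, h5⟩ := ht₁.scoped hSt hΓ hφ
  have hdd : d' ⊆ d := Finset.coe_subset.1 (hd' ▸ hd)
  -- The application rule asks for the exact intersection of saturations. Contravariance allows the
  -- domain qualifier to be shrunk from `d` to it.
  have hS : Sub Γ St (.arr T d ε₃ U.shift r) (.arr T d' ε₃ U.shift r) :=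
    .arr (.refl h1) ⟨hdd, h2⟩ (.refl h4) ⟨subset_rfl, h5⟩ ⟨subset_rfl, h3⟩
  obtain ⟨a1, a2⟩ := ht₁.subset_obs
  exact (HasType.app (ht₁.sub ⟨hS, ⟨subset_rfl, a1.trans hφ⟩, ⟨subset_rfl, a2.trans hφ⟩⟩ a1 a2)
    ht₂ hd' hp hq hε hr).weaken_qual hSt hΓ hφ hq' hqφ hε' hεφ

/-- Intersecting with `φ*` in the let rule has no effect, since `p ⊆ φ` already gives `p* ⊆ φ*`. -/
theorem HasType.letin_of_subset {Γ : Ctx S} {St : StoreTy S} {φ : Qual} {t₁ t₂ : Tm S} {T U : Ty S}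
    {p q d ε₁ ε₂ q' ε' : Qual} (hSt : St.Flat) (hΓ : ScopedCtx Γ St) (hφ : φ ⊆ domOf Γ St)
    (ht₁ : HasType Γ St φ t₁ T p ε₁) (hd : (d : Set Atom) = sat Γ St p)
    (ht₂ : HasType ((T, d) :: Γ) St φ.withVar t₂ U.shift q ε₂)
    (hq' : Qual.inst p q ⊆ q') (hqφ : q' ⊆ φ)
    (hε' : ε₁ ∪ Qual.inst p ε₂ ⊆ ε') (hεφ : ε' ⊆ φ) :
    HasType Γ St φ (.letin t₁ t₂) U q' ε' :=
  (HasType.letin ht₁ (hd.trans (Set.inter_eq_left.2 ht₁.sat_subset_sat).symm) ht₂).weaken_qual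
    hSt hΓ hφ hq' hqφ hε' hεφ

/-- Variables and values. -/
def Tm.IsAnswer (t : Tm S) : Prop := t.IsValue ∨ ∃ i, t = .var i

/-- Values and variables have no effect, and they are typable under every observation that contains
their qualifier. -/
theorem HasType.of_isAnswer {Γ : Ctx S} {St : StoreTy S} {φ ψ : Qual} {t : Tm S} {T : Ty S}
    {q ε : Qual} (h : HasType Γ St φ t T q ε) (ht : t.IsAnswer) (hq : q ⊆ ψ) :
    HasType Γ St ψ t T q ∅ := by
  induction h with
  | cst hc => exact .cst hc
  | var hx _ => exact .var hx (Finset.singleton_subset_iff.1 hq)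
  | loc hl _ => exact .loc hl (Finset.singleton_subset_iff.1 hq)
  | abs hT hp hb _ _ => exact .abs hT hp hb hq
  | sub _ hs _ _ ih =>
    exact (ih ht (hs.2.1.1.trans hq)).sub
      ⟨hs.1, hs.2.1, subset_rfl, Finset.empty_subset _⟩ hq (Finset.empty_subset _)
  | _ => rcases ht with ht | ⟨i, ht⟩ <;> cases ht

/-! ### Reachability under binders -/

/-- Flat entries have empty qualifiers, so every location is a dead end of reachability. -/
theorem StoreTy.Flat.not_reach {St : StoreTy S} (h : St.Flat) {Γ : Ctx S} {l : Loc} {b : Atom} :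
    ¬ Reach Γ St (aloc l) b := by
  intro hr
  cases hr with
  | loc hl hb => rw [(h _ _ _ hl).1] at hb; simp at hb

theorem Reach.shift {Γ : Ctx S} {St : StoreTy S} (hSt : St.Flat) {a b : Atom}
    (h : Reach Γ St a b) (x : Ty S × Qual) : Reach (x :: Γ) St (shiftAtom a) (shiftAtom b) := by
  cases h with
  | var h hb => exact .var (h.succ x) (Qual.shiftAtom_mem_shift.2 hb)
  | loc h hb => exact (hSt.not_reach (.loc (Γ := Γ) h hb)).elim

theorem reach_star_shift {Γ : Ctx S} {St : StoreTy S} (hSt : St.Flat) {a b : Atom}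
    (h : Relation.ReflTransGen (Reach Γ St) a b) (x : Ty S × Qual) :
    Relation.ReflTransGen (Reach (x :: Γ) St) (shiftAtom a) (shiftAtom b) :=
  h.lift _ fun _ _ h => h.shift hSt x

theorem reach_zero_iff {Γ : Ctx S} {St : StoreTy S} {T : Ty S} {q : Qual} {b : Atom} :
    Reach ((T, q) :: Γ) St (avar 0) b ↔ b ∈ q.shift := by
  constructor
  · intro h
    cases h with
    | var h hb => cases h; exact hb
  · exact fun h => .var (.zero Γ T q) h

/-- Outer entries are weakened past the innermost variable, so no path from an outer atom can enter
it. -/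
theorem Reach.of_shift {Γ : Ctx S} {St : StoreTy S} (hSt : St.Flat) {x : Ty S × Qual} {a b : Atom}
    (h : Reach (x :: Γ) St (shiftAtom a) b) : ∃ c, b = shiftAtom c ∧ Reach Γ St a c := by
  rcases a with i | l
  · cases h with
    | var h hb =>
      cases h with
      | succ _ h =>
        obtain ⟨c, hc, rfl⟩ := Qual.mem_shift.1 hb
        exact ⟨c, rfl, .var h hc⟩
  · exact (hSt.not_reach h).elim

/-! ### The substitution lemma -/

/-- The qualifier substitution `θ` from `Γ`, `St` to `Δ`, `St'` respects scoping, reflects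
reachability, and creates no overlap between the images of atoms in `φ` that is not the image of
something reachable from both. -/
structure Compat (Γ : Ctx S) (St : StoreTy S) (φ : Qual) (Δ : Ctx S) (St' : StoreTy S)
    (θ : ℕ → Qual) : Prop where
  dom : ScopedQ θ Γ.length St.dom Δ.length St'.dom
  reach : ∀ a a' b', a' ∈ Qual.substAtom θ a → Reach Δ St' a' b' →
    ∃ b, Relation.ReflTransGen (Reach Γ St) a b ∧ b' ∈ Qual.substAtom θ b
  overlap : ∀ a ∈ φ, ∀ b ∈ φ, ∀ c, c ∈ Qual.substAtom θ a → c ∈ Qual.substAtom θ b →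
    ∃ e, Relation.ReflTransGen (Reach Γ St) a e ∧ Relation.ReflTransGen (Reach Γ St) b e ∧
      c ∈ Qual.substAtom θ e

namespace Compat

variable {Γ Δ : Ctx S} {St St' : StoreTy S} {φ : Qual} {θ : ℕ → Qual}

theorem mono (h : Compat Γ St φ Δ St' θ) {ψ : Qual} (hψ : ψ ⊆ φ) : Compat Γ St ψ Δ St' θ :=
  ⟨h.dom, h.reach, fun a ha b hb => h.overlap a (hψ ha) b (hψ hb)⟩

/-- The new variable is its own image and overlaps no shifted qualifier, so no new overlap arises.
Only `p' ⊆ p.subst θ` is required, because all that has to be reflected is what the variable reaches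
in the target. -/
theorem lift (h : Compat Γ St φ Δ St' θ) (hSt : St.Flat) (hSt' : St'.Flat) {T T' : Ty S}
    {p p' : Qual} (hp : p' ⊆ p.subst θ) :
    Compat ((T, p) :: Γ) St φ.withVar ((T', p') :: Δ) St' (liftQ θ) := by
  refine ⟨h.dom.lift, fun a a' b' ha' hr => ?_, fun a ha b hb c hca hcb => ?_⟩
  · rcases Qual.atom_cases a with rfl | ⟨a, rfl⟩
    · rw [Qual.substAtom_liftQ_zero, Finset.mem_singleton] at ha'
      subst ha'
      have hb' : b' ∈ p'.shift := reach_zero_iff.1 hr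
      have hb' := Qual.shift_mono hp hb'
      rw [← Qual.subst_liftQ_shift, Qual.mem_subst] at hb'
      obtain ⟨b, hb, hbb⟩ := hb'
      exact ⟨b, .single (reach_zero_iff.2 hb), hbb⟩
    · rw [Qual.substAtom_liftQ_shiftAtom, Qual.mem_shift] at ha'
      obtain ⟨a', ha', rfl⟩ := ha'
      obtain ⟨c', rfl, hr'⟩ := hr.of_shift hSt'
      obtain ⟨b, hb, hbb⟩ := h.reach a a' c' ha' hr'
      refine ⟨shiftAtom b, reach_star_shift hSt hb _, ?_⟩
      rw [Qual.substAtom_liftQ_shiftAtom]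
      exact Qual.shiftAtom_mem_shift.2 hbb
  · rcases Qual.atom_cases a with rfl | ⟨a, rfl⟩
    · rw [Qual.substAtom_liftQ_zero, Finset.mem_singleton] at hca
      subst hca
      rcases Qual.atom_cases b with rfl | ⟨b, rfl⟩
      · exact ⟨_, .refl, .refl, hcb⟩
      · rw [Qual.substAtom_liftQ_shiftAtom] at hcb
        exact (Qual.zero_notMem_shift hcb).elim
    · rcases Qual.atom_cases b with rfl | ⟨b, rfl⟩
      · rw [Qual.substAtom_liftQ_zero, Finset.mem_singleton] at hcb
        subst hcb
        rw [Qual.substAtom_liftQ_shiftAtom] at hca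
        exact (Qual.zero_notMem_shift hca).elim
      · rw [Qual.substAtom_liftQ_shiftAtom] at hca hcb
        obtain ⟨c, hca', rfl⟩ := Qual.mem_shift.1 hca
        rw [Qual.shiftAtom_mem_shift] at hcb
        rw [Qual.shiftAtom_mem_withVar] at ha hb
        obtain ⟨e, h1, h2, h3⟩ := h.overlap a ha b hb c hca' hcb
        refine ⟨shiftAtom e, reach_star_shift hSt h1 _, reach_star_shift hSt h2 _, ?_⟩
        rw [Qual.substAtom_liftQ_shiftAtom]
        exact Qual.shiftAtom_mem_shift.2 h3

theorem sat_subset (h : Compat Γ St φ Δ St' θ) {q : Qual} {c : Atom}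
    (hc : c ∈ sat Δ St' (q.subst θ)) : ∃ a ∈ sat Γ St q, c ∈ Qual.substAtom θ a := by
  obtain ⟨b, hb, hr⟩ := hc
  induction hr with
  | refl =>
    obtain ⟨a, ha, hab⟩ := Qual.mem_subst.1 hb
    exact ⟨a, subset_sat _ _ _ ha, hab⟩
  | tail _ hr ih =>
    obtain ⟨a, ⟨a₀, ha₀, har⟩, hab⟩ := ih
    obtain ⟨e, he, hce⟩ := h.reach _ _ _ hab hr
    exact ⟨e, ⟨a₀, ha₀, har.trans he⟩, hce⟩

theorem sat_subset_subst (h : Compat Γ St φ Δ St' θ) {p q : Qual}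
    (hp : sat Γ St p ⊆ (q : Set Atom)) : sat Δ St' (p.subst θ) ⊆ (q.subst θ : Set Atom) := by
  intro c hc
  obtain ⟨a, ha, hca⟩ := h.sat_subset hc
  exact Qual.mem_subst.2 ⟨a, hp ha, hca⟩

/-- The overlap condition was made for this: a common element of the two target saturations comes
from atoms `a ∈ p*` and `b ∈ q*`, both observable, hence from an atom that both reach, which lies in
`p* ∩ q*`. -/
theorem sat_inter_subset (h : Compat Γ St φ Δ St' θ) {p q d : Qual}
    (hd : (d : Set Atom) = sat Γ St p ∩ sat Γ St q)
    (hp : sat Γ St p ⊆ (φ : Set Atom)) (hq : sat Γ St q ⊆ (φ : Set Atom)) :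
    sat Δ St' (p.subst θ) ∩ sat Δ St' (q.subst θ) ⊆ (d.subst θ : Set Atom) := by
  rintro c ⟨hcp, hcq⟩
  obtain ⟨a, ha, hca⟩ := h.sat_subset hcp
  obtain ⟨b, hb, hcb⟩ := h.sat_subset hcq
  obtain ⟨e, h1, h2, h3⟩ := h.overlap a (hp ha) b (hq hb) c hca hcb
  refine Qual.mem_subst.2 ⟨e, ?_, h3⟩
  rw [← Finset.mem_coe, hd]
  obtain ⟨a₀, ha₀, hra⟩ := ha
  obtain ⟨b₀, hb₀, hrb⟩ := hb
  exact ⟨⟨a₀, ha₀, hra.trans h1⟩, ⟨b₀, hb₀, hrb.trans h2⟩⟩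

end Compat

theorem QSub.subst {Γ Δ : Ctx S} {St St' : StoreTy S} {θ : ℕ → Qual} {p q : Qual}
    (h : QSub Γ St p q) (hθ : ScopedQ θ Γ.length St.dom Δ.length St'.dom) :
    QSub Δ St' (p.subst θ) (q.subst θ) :=
  ⟨Qual.subst_mono θ h.1, hθ.subst_subset h.2⟩

theorem Sub.subst {Γ Δ : Ctx S} {St St' : StoreTy S} {θ : ℕ → Qual} {T U : Ty S}
    (h : Sub Γ St T U) (hθ : ScopedQ θ Γ.length St.dom Δ.length St'.dom) :
    Sub Δ St' (T.subst θ) (U.subst θ) := by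
  induction h generalizing Δ θ with
  | base => exact .base ..
  | ref => exact .ref ..
  | arr _ hp _ hq hε ih₁ ih₂ =>
    exact .arr (ih₁ hθ) (hp.subst hθ) (ih₂ hθ.lift) (hq.subst hθ.lift) (hε.subst hθ.lift)

/-- The predicate `W` abstracts what replaces a variable, so that one induction serves twice: first
with variables, which yields weakening, then with values, whose passage under a binder needs that
weakening. -/
theorem HasType.subst_of {Γ : Ctx S} {St St' : StoreTy S} {φ : Qual} {t : Tm S} {T : Ty S}
    {q ε : Qual} (h : HasType Γ St φ t T q ε) (W : Ctx S → Tm S → Ty S → Qual → Prop)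
    (hW : ∀ Δ φ t T q, W Δ t T q → q ⊆ φ → HasType Δ St' φ t T q ∅)
    (hW₀ : ∀ Δ T q, W ((T, q) :: Δ) (.var 0) T.shift {avar 0})
    (hWs : ∀ Δ t T q b, ScopedCtx Δ St' → ScopedCtx (b :: Δ) St' → q ⊆ domOf Δ St' → W Δ t T q →
      W (b :: Δ) (t.rename Nat.succ) T.shift q.shift)
    (hSt' : St'.Flat) (hSt : St.Flat) (hE : St'.Extends St)
    {Δ : Ctx S} {φ' : Qual} {θ : ℕ → Qual} {s : ℕ → Tm S}
    (hΔ : ScopedCtx Δ St') (hθ : Compat Γ St φ Δ St' θ)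
    (hs : ∀ i T q, InCtx Γ i T q → W Δ (s i) (T.subst θ) (θ i))
    (hφ : φ.subst θ ⊆ φ') (hφ' : φ' ⊆ domOf Δ St') :
    HasType Δ St' φ' (t.subst s) (T.subst θ) (q.subst θ) (ε.subst θ) := by
  have lift : ∀ {Γ Δ : Ctx S} {θ : ℕ → Qual} {s : ℕ → Tm S} {T : Ty S} {p p' : Qual},
      ScopedCtx Δ St' → ScopedCtx ((T.subst θ, p') :: Δ) St' →
      (∀ i < Γ.length, θ i ⊆ domOf Δ St') →
      (∀ i T q, InCtx Γ i T q → W Δ (s i) (T.subst θ) (θ i)) →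
      ∀ i U q, InCtx ((T, p) :: Γ) i U q →
        W ((T.subst θ, p') :: Δ) (Tm.liftSub s i) (U.subst (liftQ θ)) (liftQ θ i) := by
    intro Γ Δ θ s T p p' hΔ hΔ' hθ hs i U q hi
    cases hi with
    | zero => rw [Ty.subst_liftQ_shift]; exact hW₀ _ _ _
    | succ _ hi =>
      rw [Ty.subst_liftQ_shift]
      exact hWs _ _ _ _ _ hΔ hΔ' (hθ _ hi.lt_length) (hs _ _ _ hi)
  induction h generalizing Δ φ' θ s with
  | cst hc => exact .cst hc
  | var hx hv =>
    rw [Qual.subst_singleton]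
    exact hW _ _ _ _ _ (hs _ _ _ hx) ((Qual.substAtom_subset_subst hv).trans hφ)
  | loc hl hv =>
    rw [hSt.subst_eq hl, Qual.subst_singleton]
    exact .loc (hE _ _ hl) (hφ (Qual.mem_subst.2 ⟨_, hv, by simp⟩))
  | @abs Γ St φ t T U p q r ε hT hp ht hq ih =>
    have hqφ := (Qual.subst_mono θ hq).trans hφ
    have hT' := hθ.dom.ty_subst hT
    have hp' := hθ.dom.subst_subset hp
    have hΔ' := hΔ.cons hT' hp'
    refine .abs hT' hp' ?_ hqφ
    rw [← Qual.subst_liftQ_withVar]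
    -- The body observes only `q` and its parameter, so control of overlaps among the atoms of `q`
    -- is enough.
    refine ih hSt hE hΔ' ((hθ.mono hq).lift hSt hSt' subset_rfl)
      (lift hΔ hΔ' hθ.dom.1 hs) subset_rfl ?_
    rw [Qual.subst_liftQ_withVar]
    exact withVar_subset_domOf (hqφ.trans hφ')
  | @app Γ St φ t₁ t₂ T U p q r d ε₁ ε₂ ε₃ ht₁ ht₂ hd hp hq hε hr ih₁ ih₂ =>
    have i₁ := ih₁ hSt hE hΔ hθ hs hφ hφ'
    have i₂ := ih₂ hSt hE hΔ hθ hs hφ hφ'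
    simp only [Ty.subst, Ty.subst_liftQ_shift] at i₁
    have hr' : r.subst (liftQ θ) ⊆ φ'.withVar := by
      have := Qual.subst_mono (liftQ θ) hr
      rw [Qual.subst_liftQ_withVar] at this
      exact this.trans (Qual.withVar_mono hφ)
    have hε' : ε₃.subst (liftQ θ) ⊆ (q.subst θ).withVar := by
      have := Qual.subst_mono (liftQ θ) hε
      rwa [Qual.subst_liftQ_withVar] at this
    refine i₁.app_of_subset hSt' hΔ hφ' i₂ (hθ.sat_inter_subset hd hp hq)
      ((hθ.sat_subset_subst hp).trans (Finset.coe_subset.2 hφ))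
      ((hθ.sat_subset_subst hq).trans (Finset.coe_subset.2 hφ)) hε' hr'
      (Qual.subst_inst ..).ge ?_ ?_ ?_
    · rw [Qual.subst_inst]
      exact Qual.inst_subset i₂.subset_obs.1 hr'
    · rw [Qual.subst_union, Qual.subst_union, Qual.subst_inst]
    · rw [Qual.subst_union, Qual.subst_union, Qual.subst_inst]
      exact Finset.union_subset (Finset.union_subset i₁.subset_obs.2 i₂.subset_obs.2)
        (Qual.inst_subset i₂.subset_obs.1 (hε'.trans (Qual.withVar_mono i₁.subset_obs.1)))
  | @letin Γ St φ t₁ t₂ T U p q d ε₁ ε₂ ht₁ hd ht₂ ih₁ ih₂ =>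
    have i₁ := ih₁ hSt hE hΔ hθ hs hφ hφ'
    have hsat : sat Γ St p ⊆ (d : Set Atom) := by
      rw [hd]
      exact Set.subset_inter subset_rfl ht₁.sat_subset_sat
    have hd' := hθ.sat_subset_subst hsat
    -- The saturation after substitution may be smaller than the substituted `d`. The let rule wants
    -- it exactly, and `Compat.lift` tolerates the smaller qualifier.
    obtain ⟨d', hd''⟩ := exists_coe_eq_of_subset hd'
    have hΔ' : ScopedCtx ((T.subst θ, d') :: Δ) St' := by
      refine hΔ.cons (i₁.scoped hSt' hΔ hφ') ?_
      rw [← Finset.coe_subset, hd'']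
      exact sat_subset_domOf hΔ hSt' (i₁.subset_obs.1.trans hφ')
    have i₂ := ih₂ (φ' := φ'.withVar) hSt hE hΔ'
      (hθ.lift hSt hSt' (Finset.coe_subset.1 (hd'' ▸ hd')))
      (lift hΔ hΔ' hθ.dom.1 hs)
      (by rw [Qual.subst_liftQ_withVar]; exact Qual.withVar_mono hφ)
      (withVar_subset_domOf hφ')
    rw [Ty.subst_liftQ_shift] at i₂
    refine i₁.letin_of_subset hSt' hΔ hφ' hd'' i₂ (Qual.subst_inst ..).ge ?_ ?_ ?_
    · rw [Qual.subst_inst]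
      exact Qual.inst_subset i₁.subset_obs.1 i₂.subset_obs.1
    · rw [Qual.subst_union, Qual.subst_inst]
    · rw [Qual.subst_union, Qual.subst_inst]
      exact Finset.union_subset i₁.subset_obs.2
        (Qual.inst_subset i₁.subset_obs.1 i₂.subset_obs.2)
  | ref _ _ ih₁ ih₂ =>
    rw [Qual.subst_union, Qual.subst_union]
    exact .ref (ih₁ hSt hE hΔ hθ hs hφ hφ') (ih₂ hSt hE hΔ hθ hs hφ hφ')
  | deref _ ih =>
    rw [Qual.subst_union]
    exact .deref (ih hSt hE hΔ hθ hs hφ hφ')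
  | assign _ _ ih₁ ih₂ =>
    rw [Qual.subst_union, Qual.subst_union]
    exact .assign (ih₁ hSt hE hΔ hθ hs hφ hφ') (ih₂ hSt hE hΔ hθ hs hφ hφ')
  | sub _ hsub hq hε ih =>
    exact (ih hSt hE hΔ hθ hs hφ hφ').sub
      ⟨hsub.1.subst hθ.dom, hsub.2.1.subst hθ.dom, hsub.2.2.subst hθ.dom⟩
      ((Qual.subst_mono θ hq).trans hφ) ((Qual.subst_mono θ hε).trans hφ)

/-! ### Weakening and substitution of values -/

theorem Tm.liftSub_var (ρ : ℕ → ℕ) :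
    Tm.liftSub (fun i => Tm.var (S := S) (ρ i)) = fun i => Tm.var (liftRen ρ i) := by
  funext i; cases i <;> rfl

theorem Tm.rename_eq_subst (ρ : ℕ → ℕ) (t : Tm S) : t.rename ρ = t.subst fun i => .var (ρ i) := by
  induction t generalizing ρ <;> simp_all [Tm.rename, Tm.subst, Tm.liftSub_var]

theorem HasType.rename {Γ Δ : Ctx S} {St : StoreTy S} {φ φ' : Qual} {t : Tm S} {T : Ty S}
    {q ε : Qual} (h : HasType Γ St φ t T q ε) (hSt : St.Flat) (hΔ : ScopedCtx Δ St) {ρ : ℕ → ℕ}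
    (hθ : Compat Γ St φ Δ St (renQ ρ))
    (hρ : ∀ i T q, InCtx Γ i T q → ∃ q', InCtx Δ (ρ i) (T.subst (renQ ρ)) q')
    (hφ : φ.subst (renQ ρ) ⊆ φ') (hφ' : φ' ⊆ domOf Δ St) :
    HasType Δ St φ' (t.rename ρ) (T.subst (renQ ρ)) (q.subst (renQ ρ)) (ε.subst (renQ ρ)) := by
  rw [Tm.rename_eq_subst]
  refine h.subst_of (fun Δ t T q => ∃ i q', t = .var i ∧ q = {avar i} ∧ InCtx Δ i T q')
    ?_ ?_ ?_ hSt hSt (.refl St) hΔ hθ ?_ hφ hφ'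
  · rintro Δ φ _ T _ ⟨i, q', rfl, rfl, hi⟩ hq
    exact .var hi (Finset.singleton_subset_iff.1 hq)
  · exact fun Δ T q => ⟨0, _, rfl, rfl, .zero ..⟩
  · rintro Δ _ T _ b - - - ⟨i, q', rfl, rfl, hi⟩
    exact ⟨i + 1, _, rfl, rfl, hi.succ b⟩
  · intro i T q hi
    obtain ⟨q', hq'⟩ := hρ i T q hi
    exact ⟨ρ i, q', rfl, rfl, hq'⟩

theorem substAtom_renQ_succ (a : Atom) : Qual.substAtom (renQ Nat.succ) a = {shiftAtom a} := by
  rcases a with i | l <;> rfl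

/-- Shifting is injective on atoms, so distinct atoms have disjoint images and the overlap condition
is trivial. -/
theorem HasType.shift {Γ : Ctx S} {St : StoreTy S} {φ : Qual} {t : Tm S} {T : Ty S}
    {q ε : Qual} (h : HasType Γ St φ t T q ε) (hSt : St.Flat) {b : Ty S × Qual}
    (hb : ScopedCtx (b :: Γ) St) (hφ : φ ⊆ domOf Γ St) :
    HasType (b :: Γ) St φ.shift (t.rename Nat.succ) T.shift q.shift ε.shift := by
  simp only [Qual.shift_eq_subst, Ty.shift_eq_subst]
  refine h.rename hSt hb ⟨scopedQ_succ _ _, ?_, ?_⟩ ?_ subset_rfl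
    (Qual.shift_eq_subst φ ▸ shift_subset_domAtoms hφ)
  · intro a a' b' ha' hr
    rw [substAtom_renQ_succ, Finset.mem_singleton] at ha'
    subst ha'
    obtain ⟨c, rfl, hc⟩ := hr.of_shift hSt
    exact ⟨c, .single hc, by simp [substAtom_renQ_succ]⟩
  · intro a _ b _ c hca hcb
    simp only [substAtom_renQ_succ, Finset.mem_singleton] at hca hcb
    obtain rfl : a = b := Qual.shiftAtom_injective (hca.symm.trans hcb)
    exact ⟨a, .refl, .refl, by simp [substAtom_renQ_succ, hca]⟩
  · intro i T q hi
    rw [← Ty.shift_eq_subst]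
    exact ⟨_, hi.succ b⟩

theorem Tm.IsAnswer.rename {t : Tm S} (h : t.IsAnswer) (ρ : ℕ → ℕ) : (t.rename ρ).IsAnswer := by
  rcases h with h | ⟨i, rfl⟩
  · refine .inl ?_
    cases h <;> constructor
  · exact .inr ⟨_, rfl⟩

/-- Simultaneous substitution of values for variables and of qualifiers for the corresponding
atoms. -/
theorem HasType.subst {Γ Δ : Ctx S} {St St' : StoreTy S} {φ φ' : Qual} {t : Tm S} {T : Ty S}
    {q ε : Qual} (h : HasType Γ St φ t T q ε) (hSt : St.Flat) (hSt' : St'.Flat)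
    (hE : St'.Extends St) {θ : ℕ → Qual} {s : ℕ → Tm S}
    (hΔ : ScopedCtx Δ St') (hθ : Compat Γ St φ Δ St' θ)
    (hs : ∀ i T q, InCtx Γ i T q →
      (s i).IsAnswer ∧ HasType Δ St' (θ i) (s i) (T.subst θ) (θ i) ∅)
    (hφ : φ.subst θ ⊆ φ') (hφ' : φ' ⊆ domOf Δ St') :
    HasType Δ St' φ' (t.subst s) (T.subst θ) (q.subst θ) (ε.subst θ) := by
  refine h.subst_of (fun Δ t T q => t.IsAnswer ∧ HasType Δ St' q t T q ∅)
    ?_ ?_ ?_ hSt' hSt hE hΔ hθ hs hφ hφ'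
  · exact fun Δ φ t T q ht hq => ht.2.of_isAnswer ht.1 hq
  · exact fun Δ T q => ⟨.inr ⟨0, rfl⟩, .var (.zero ..) (Finset.mem_singleton_self _)⟩
  · exact fun Δ t T q b _ hb hq ht => ⟨ht.1.rename _, ht.2.shift hSt' hb hq⟩

theorem Tm.subst_var (t : Tm S) : t.subst Tm.var = t := by
  have h : Tm.liftSub (Tm.var (S := S)) = Tm.var := by
    funext i; cases i <;> rfl
  induction t <;> simp_all [Tm.subst]

/-- Weakening of the store typing and of the observation for closed terms. -/
theorem HasType.weaken_store {St St' : StoreTy S} {t : Tm S} {T : Ty S}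
    {q ε : Qual} (h : HasType [] St St.obs t T q ε) (hSt : St.Flat) (hSt' : St'.Flat)
    (hE : St'.Extends St) : HasType [] St' St'.obs t T q ε := by
  have hobs : St.obs ⊆ St'.obs := Finset.image_subset_image hE.dom_subset
  have hid : ∀ a, Qual.substAtom (renQ id) a = {a} := by rintro (i | l) <;> rfl
  have := h.subst (φ' := St'.obs) hSt hSt' hE (θ := renQ id) (s := Tm.var) (scopedCtx_nil _)
    ⟨⟨by simp, hE.dom_subset⟩, ?_, ?_⟩ (fun i T q hi => by cases hi)
    (by rwa [Qual.subst_renQ_id]) (St'.obs_eq_domAtoms).le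
  · simpa only [Qual.subst_renQ_id, Ty.subst_renQ_id, Tm.subst_var] using this
  · intro a a' b' _ hr
    cases hr with
    | var hi => cases hi
    | loc hl hb => exact (hSt'.not_reach (.loc (Γ := []) hl hb)).elim
  · intro a _ b _ c hca hcb
    rw [hid, Finset.mem_singleton] at hca hcb
    subst hca hcb
    exact ⟨c, .refl, .refl, by simp [hid]⟩

/-! ### Removing atoms of non-base type from the qualifiers of base types -/

/-- Whether a type is a base type. -/
def Ty.isBase : Ty S → Bool
  | .base _ => true
  | _ => false

/-- Extend a predicate on atoms under one binder. -/
def liftB (b : Bool) (β : Atom → Bool) : Atom → Bool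
  | Sum.inl 0 => b
  | Sum.inl (i + 1) => β (Sum.inl i)
  | Sum.inr l => β (Sum.inr l)

@[simp] theorem liftB_zero (b : Bool) (β : Atom → Bool) : liftB b β (avar 0) = b := rfl

@[simp] theorem liftB_shiftAtom (b : Bool) (β : Atom → Bool) (a : Atom) :
    liftB b β (shiftAtom a) = β a := by
  rcases a with i | l <;> rfl

/-- Restrict `q` to the atoms that satisfy `β`, if it qualifies a base type. -/
def Qual.clean (β : Atom → Bool) (b : Bool) (q : Qual) : Qual :=
  if b then q.filter fun a => β a else q

/-- Restrict the qualifiers of all base types within a type to the atoms that satisfy `β` and the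
bound variables of base type. -/
def Ty.clean : (Atom → Bool) → Ty S → Ty S
  | _, base B => base B
  | _, ref B => ref B
  | β, arr T p ε U r =>
      arr (clean β T) (Qual.clean β T.isBase p) ε (clean (liftB T.isBase β) U)
        (Qual.clean (liftB T.isBase β) U.isBase r)

namespace Qual

@[simp] theorem clean_true (β : Atom → Bool) (q : Qual) :
    clean β true q = q.filter fun a => β a := rfl

@[simp] theorem clean_false (β : Atom → Bool) (q : Qual) : clean β false q = q := rfl

theorem clean_subset (β : Atom → Bool) (b : Bool) (q : Qual) : clean β b q ⊆ q := by
  cases b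
  · exact subset_rfl
  · exact Finset.filter_subset _ _

theorem clean_mono (β : Atom → Bool) (b : Bool) {p q : Qual} (h : p ⊆ q) :
    clean β b p ⊆ clean β b q := by
  cases b
  · exact h
  · exact Finset.filter_subset_filter _ h

theorem mem_clean {β : Atom → Bool} {b : Bool} {q : Qual} {a : Atom} :
    a ∈ clean β b q ↔ a ∈ q ∧ (b = true → β a = true) := by
  cases b <;> simp

theorem clean_rename (β : Atom → Bool) (b : Bool) (ρ : ℕ → ℕ) (q : Qual) :
    clean β b (rename ρ q) = rename ρ (clean (β ∘ Sum.map ρ id) b q) := by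
  cases b
  · rfl
  · exact Finset.filter_image

/-- If the result is of base type, its cleaned qualifier mentions the bound variable only when the
argument is of base type too, and then the argument's qualifier has been cleaned as well. -/
theorem inst_clean_subset (β : Atom → Bool) (b c : Bool) (p r : Qual) :
    inst (clean β b p) (clean (liftB b β) c r) ⊆ clean β c (inst p r) := by
  intro a ha
  simp only [mem_inst, mem_clean, liftB_zero, liftB_shiftAtom] at ha ⊢
  tauto

end Qual

theorem liftB_comp (b : Bool) (β : Atom → Bool) (ρ : ℕ → ℕ) :
    liftB b β ∘ Sum.map (liftRen ρ) id = liftB b (β ∘ Sum.map ρ id) := by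
  funext a
  rcases a with (_ | i) | l <;> rfl

namespace Ty

@[simp] theorem isBase_rename (ρ : ℕ → ℕ) (T : Ty S) : (rename ρ T).isBase = T.isBase := by
  cases T <;> rfl

@[simp] theorem isBase_shift (T : Ty S) : T.shift.isBase = T.isBase := isBase_rename _ T

theorem clean_rename (β : Atom → Bool) (ρ : ℕ → ℕ) (T : Ty S) :
    clean β (rename ρ T) = rename ρ (clean (β ∘ Sum.map ρ id) T) := by
  induction T generalizing β ρ with
  | base B => rfl
  | ref B => rfl
  | arr T p ε U r ihT ihU =>
    simp only [rename, clean, isBase_rename, ihT, ihU, Qual.clean_rename, liftB_comp]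

theorem clean_shift (b : Bool) (β : Atom → Bool) (T : Ty S) :
    clean (liftB b β) T.shift = (clean β T).shift := by
  unfold shift
  rw [clean_rename]
  congr 2
  funext a
  exact liftB_shiftAtom b β a

theorem Scoped.clean {T : Ty S} {n : ℕ} {D : Finset Loc} (h : T.Scoped n D) (β : Atom → Bool) :
    (T.clean β).Scoped n D := by
  induction T generalizing β n with
  | base B => trivial
  | ref B => trivial
  | arr T p ε U r ihT ihU =>
    obtain ⟨h1, h2, h3, h4, h5⟩ := h
    exact ⟨ihT h1 _, (Qual.clean_subset ..).trans h2, h3, ihU h4 _,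
      (Qual.clean_subset ..).trans h5⟩

end Ty

theorem clean_shift_qual (b c : Bool) (β : Atom → Bool) (q : Qual) :
    Qual.clean (liftB b β) c q.shift = (Qual.clean β c q).shift := by
  unfold Qual.shift
  rw [Qual.clean_rename]
  congr 2
  funext a
  exact liftB_shiftAtom b β a

theorem Sub.isBase_eq {Γ : Ctx S} {St : StoreTy S} {T U : Ty S} (h : Sub Γ St T U) :
    T.isBase = U.isBase := by
  cases h <;> rfl

/-- Subtyping preserves being a base type, so both sides are cleaned by the same predicate. Of the
context only its length matters. -/
theorem Sub.clean {Γ Δ : Ctx S} {St : StoreTy S} {T U : Ty S} (h : Sub Γ St T U)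
    (β : Atom → Bool) (hΔ : Δ.length = Γ.length) : Sub Δ St (T.clean β) (U.clean β) := by
  induction h generalizing Δ β with
  | base => exact .base ..
  | ref => exact .ref ..
  | @arr Γ St T U V W o p q r ε₁ ε₂ hdom hp hcod hq hε ih₁ ih₂ =>
    have hl : ∀ b : Ty S × Qual, domOf (b :: Δ) St = domOf ((U, p) :: Γ) St := by
      intro b; simp [domOf, hΔ]
    have hl' : domOf Δ St = domOf Γ St := by simp [domOf, hΔ]
    simp only [Ty.clean, hdom.isBase_eq, hcod.isBase_eq]
    refine .arr (ih₁ β hΔ) ⟨Qual.clean_mono _ _ hp.1, ?_⟩ (ih₂ _ (by simp [hΔ]))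
      ⟨Qual.clean_mono _ _ hq.1, ?_⟩ ⟨hε.1, ?_⟩
    · rw [hl']; exact (Qual.clean_subset ..).trans hp.2
    · rw [hl]; exact (Qual.clean_subset ..).trans hq.2
    · rw [hl]; exact hε.2

/-- `Δ` binds the variables of `Γ` with cleaned types and at most the cleaned qualifiers, and `β`
tells the atoms of base type. -/
structure Cleans (β : Atom → Bool) (Γ Δ : Ctx S) (St : StoreTy S) : Prop where
  length_eq : Δ.length = Γ.length
  ctx : ∀ i T q, InCtx Γ i T q → β (avar i) = T.isBase ∧
    ∃ q', InCtx Δ i (T.clean β) q' ∧ q' ⊆ Qual.clean β T.isBase q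
  store : ∀ l T q, St.lookup l = some (T, q) → β (aloc l) = T.isBase
  ctx' : ∀ i T q, InCtx Δ i T q → ∃ U r, InCtx Γ i U r ∧ q ⊆ Qual.clean β U.isBase r

namespace Cleans

variable {β : Atom → Bool} {Γ Δ : Ctx S} {St : StoreTy S}

theorem cons (h : Cleans β Γ Δ St) {T : Ty S} {q q' : Qual} (hq : q' ⊆ Qual.clean β T.isBase q) :
    Cleans (liftB T.isBase β) ((T, q) :: Γ) ((T.clean β, q') :: Δ) St := by
  refine ⟨by simp [h.length_eq], fun i U r hi => ?_, h.store, fun i U r hi => ?_⟩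
  · cases hi with
    | zero =>
      refine ⟨by simp, q'.shift, ?_, ?_⟩
      · rw [Ty.clean_shift]; exact .zero ..
      · rw [Ty.isBase_shift, clean_shift_qual]; exact Qual.shift_mono hq
    | succ _ hi =>
      obtain ⟨h1, r', h2, h3⟩ := h.ctx _ _ _ hi
      refine ⟨by rw [Ty.isBase_shift, ← h1]; rfl, r'.shift, ?_, ?_⟩
      · rw [Ty.clean_shift]; exact h2.succ _
      · rw [Ty.isBase_shift, clean_shift_qual]; exact Qual.shift_mono h3
  · cases hi with
    | zero =>
      refine ⟨_, _, .zero .., ?_⟩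
      rw [Ty.isBase_shift, clean_shift_qual]; exact Qual.shift_mono hq
    | succ _ hi =>
      obtain ⟨V, r', h2, h3⟩ := h.ctx' _ _ _ hi
      refine ⟨_, _, h2.succ _, ?_⟩
      rw [Ty.isBase_shift, clean_shift_qual]; exact Qual.shift_mono h3

theorem reach (h : Cleans β Γ Δ St) {a b : Atom} (hr : Reach Δ St a b) :
    Reach Γ St a b := by
  cases hr with
  | var hi hb =>
    obtain ⟨U, r, h1, h2⟩ := h.ctx' _ _ _ hi
    exact .var h1 (Qual.clean_subset _ _ _ (h2 hb))
  | loc hl hb => exact .loc hl hb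

theorem sat_subset (h : Cleans β Γ Δ St) {p q : Qual} (hp : p ⊆ q) : sat Δ St p ⊆ sat Γ St q :=
  fun _ ⟨b, hb, hr⟩ => ⟨b, hp hb, Relation.ReflTransGen.mono (fun _ _ => h.reach) _ _ hr⟩

/-- A variable of base type is bound in `Δ` with a cleaned qualifier, so atoms of base type reach
only atoms of base type. -/
theorem reach_base (h : Cleans β Γ Δ St) (hSt : St.Flat) {a b : Atom} (hr : Reach Δ St a b)
    (ha : β a = true) : β b = true := by
  cases hr with
  | var hi hb =>
    obtain ⟨U, r, h1, h2⟩ := h.ctx' _ _ _ hi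
    exact (Qual.mem_clean.1 (h2 hb)).2 ((h.ctx _ _ _ h1).1 ▸ ha)
  | loc hl hb => exact (hSt.not_reach (.loc (Γ := Δ) hl hb)).elim

theorem sat_clean_subset (h : Cleans β Γ Δ St) (hSt : St.Flat) {p : Qual} {b : Bool} {c : Atom}
    (hc : c ∈ sat Δ St (Qual.clean β b p)) : c ∈ sat Γ St p ∧ (b = true → β c = true) := by
  refine ⟨h.sat_subset (Qual.clean_subset ..) hc, fun hb => ?_⟩
  obtain ⟨a, ha, hr⟩ := hc
  induction hr with
  | refl => exact (Qual.mem_clean.1 ha).2 hb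
  | tail _ hr ih => exact h.reach_base hSt hr ih

end Cleans

/-- Base-typed variables and locations carry only themselves as qualifiers, and every other rule
respects the restriction. Cleaning must also act inside function types and contexts, because base
types occur there as domains and results. Effects stay as they are. -/
theorem HasType.clean {Γ Δ : Ctx S} {St : StoreTy S} {φ : Qual} {t : Tm S} {T : Ty S}
    {q ε : Qual} {β : Atom → Bool} (h : HasType Γ St φ t T q ε) (hC : Cleans β Γ Δ St)
    (hSt : St.Flat) (hΔ : ScopedCtx Δ St) (hφ : φ ⊆ domOf Γ St) :
    HasType Δ St φ t (T.clean β) (q.clean β T.isBase) ε := by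
  have hdom : ∀ {Γ Δ : Ctx S}, Δ.length = Γ.length → domOf Δ St = domOf Γ St := by
    intro Γ Δ h; simp [domOf, h]
  induction h generalizing Δ β with
  | cst hc => exact .cst hc
  | @var Γ St φ i T q hx hv =>
    obtain ⟨h1, q', h2, -⟩ := hC.ctx _ _ _ hx
    have : Qual.clean β T.isBase {avar i} = {avar i} := by
      ext a
      rw [Qual.mem_clean, Finset.mem_singleton]
      exact ⟨And.left, by rintro rfl; exact ⟨rfl, h1.trans⟩⟩
    rw [this]
    exact .var h2 hv
  | @loc Γ St φ l T q hl hv =>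
    have : Qual.clean β T.isBase {aloc l} = {aloc l} := by
      ext a
      rw [Qual.mem_clean, Finset.mem_singleton]
      exact ⟨And.left, by rintro rfl; exact ⟨rfl, (hC.store _ _ _ hl).trans⟩⟩
    rw [this]
    have hT : T.clean β = T := by
      obtain ⟨-, ⟨B, rfl⟩ | ⟨B, rfl⟩⟩ := hSt _ _ _ hl <;> rfl
    rw [hT]
    exact .loc hl hv
  | @abs Γ St φ t T U p q r ε hT hp ht hq ih =>
    have hT' : (T.clean β).Scoped Δ.length St.dom := hC.length_eq ▸ hT.clean β
    have hp' : Qual.clean β T.isBase p ⊆ domOf Δ St :=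
      hdom hC.length_eq ▸ (Qual.clean_subset ..).trans hp
    exact .abs hT' hp' (ih (hC.cons subset_rfl) hSt (hΔ.cons hT' hp')
      (withVar_subset_domAtoms (hq.trans hφ)) hdom) hq
  | @app Γ St φ t₁ t₂ T U p q r d ε₁ ε₂ ε₃ ht₁ ht₂ hd hp hq hε hr ih₁ ih₂ =>
    have i₁ := ih₁ hC hSt hΔ hφ hdom
    have i₂ := ih₂ hC hSt hΔ hφ hdom
    simp only [Ty.clean, Ty.clean_shift, Ty.isBase_shift] at i₁
    have hpp := Qual.clean_subset β T.isBase p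
    refine i₁.app_of_subset hSt hΔ (hdom hC.length_eq ▸ hφ) i₂ ?_
      ((hC.sat_subset hpp).trans hp) ((hC.sat_subset subset_rfl).trans hq) hε
      ((Qual.clean_subset ..).trans hr) (Qual.inst_clean_subset ..) ?_
      (Finset.union_subset_union subset_rfl (Qual.inst_mono hpp subset_rfl)) ?_
    -- For an argument of base type the domain qualifier has itself been cleaned, so the overlap
    -- must consist of base-type atoms; saturating a cleaned qualifier ensures this.
    · rintro c ⟨hcp, hcq⟩
      obtain ⟨h1, h2⟩ := hC.sat_clean_subset hSt hcp
      refine Qual.mem_clean.2 ⟨?_, h2⟩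
      rw [← Finset.mem_coe, hd]
      exact ⟨h1, hC.sat_subset subset_rfl hcq⟩
    · exact (Qual.clean_subset ..).trans (Qual.inst_subset ht₂.subset_obs.1 hr)
    · exact (HasType.app ht₁ ht₂ hd hp hq hε hr).subset_obs.2
  | @letin Γ St φ t₁ t₂ T U p q d ε₁ ε₂ ht₁ hd ht₂ ih₁ ih₂ =>
    have i₁ := ih₁ hC hSt hΔ hφ hdom
    have hpp := Qual.clean_subset β T.isBase p
    have hφ' : φ ⊆ domOf Δ St := hdom hC.length_eq ▸ hφ
    have hsub : sat Δ St (Qual.clean β T.isBase p) ⊆ (Qual.clean β T.isBase d : Set Atom) := by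
      intro c hc
      obtain ⟨h1, h2⟩ := hC.sat_clean_subset hSt hc
      refine Qual.mem_clean.2 ⟨?_, h2⟩
      rw [← Finset.mem_coe, hd]
      exact ⟨h1, ht₁.sat_subset_sat h1⟩
    obtain ⟨d', hd'⟩ := exists_coe_eq_of_subset hsub
    have hΔ' : ScopedCtx ((T.clean β, d') :: Δ) St := by
      refine hΔ.cons (i₁.scoped hSt hΔ hφ') ?_
      rw [← Finset.coe_subset, hd']
      exact sat_subset_domOf hΔ hSt (i₁.subset_obs.1.trans hφ')
    have i₂ := ih₂ (hC.cons (Finset.coe_subset.1 (hd' ▸ hsub))) hSt hΔ'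
      (withVar_subset_domAtoms hφ) hdom
    rw [Ty.clean_shift, Ty.isBase_shift] at i₂
    refine i₁.letin_of_subset hSt hΔ hφ' hd' i₂ (Qual.inst_clean_subset ..) ?_
      (Finset.union_subset_union subset_rfl (Qual.inst_mono hpp subset_rfl)) ?_
    · exact (Qual.clean_subset ..).trans
        (Qual.inst_subset ht₁.subset_obs.1 ht₂.subset_obs.1)
    · exact (HasType.letin ht₁ hd ht₂).subset_obs.2
  | @ref Γ St φ t₁ t₂ B q ε₁ ε₂ ht₁ ht₂ ih₁ ih₂ =>
    have i₁ := ih₁ hC hSt hΔ hφ hdom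
    have i₂ := ih₂ hC hSt hΔ hφ hdom
    -- The capability has base type, so cleaning shrinks its contribution to the effect; subsumption
    -- restores the original effect.
    exact (HasType.ref i₁ i₂).weaken_qual hSt hΔ (hdom hC.length_eq ▸ hφ) subset_rfl
      (Finset.empty_subset _) (Finset.union_subset_union subset_rfl (Qual.clean_subset ..))
      (HasType.ref ht₁ ht₂).subset_obs.2
  | deref ht ih => exact .deref (ih hC hSt hΔ hφ hdom)
  | @assign Γ St φ t₁ t₂ B q ε₁ ε₂ ht₁ ht₂ ih₁ ih₂ =>
    exact .assign (ih₁ hC hSt hΔ hφ hdom) (ih₂ hC hSt hΔ hφ hdom)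
  | @sub Γ St φ t T U p q ε₁ ε₂ ht hs hq hε ih =>
    have hl := hdom hC.length_eq
    have hq' := (Qual.clean_subset β T.isBase q).trans hq
    rw [← hs.1.isBase_eq]
    refine (ih hC hSt hΔ hφ hdom).sub ⟨hs.1.clean β hC.length_eq,
      ⟨Qual.clean_mono β _ hs.2.1.1, ?_⟩, ⟨hs.2.2.1, ?_⟩⟩ hq' hε
    · rw [hl]; exact hq'.trans hφ
    · rw [hl]; exact hs.2.2.2

/-- A closed term of base type can be typed without the locations of reference type. -/
theorem HasType.restrict_base {St : StoreTy S} {t : Tm S} {B : S.Base} {q q' ε : Qual}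
    (h : HasType [] St St.obs t (.base B) q ε) (hSt : St.Flat) (hqq : q' ⊆ q)
    (hq : ∀ l, aloc l ∈ q → aloc l ∉ q' → ∃ C r, St.lookup l = some (.ref C, r)) :
    HasType [] St St.obs t (.base B) q' ε := by
  -- The default `false` serves for variables, absent from a closed context, and for unbound
  -- locations; both are thereby discarded.
  let β : Atom → Bool := Sum.elim (fun _ => false) fun l =>
    ((St.lookup l).map fun b => b.1.isBase).getD false
  have hφ : St.obs ⊆ domOf [] St := St.obs_eq_domAtoms.le
  have := h.clean (β := β) (Δ := [])
    ⟨rfl, fun _ _ _ h => (by cases h), fun l T q hl => by simp [β, hl], fun _ _ _ h => (by cases h)⟩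
    hSt (scopedCtx_nil St) hφ
  refine this.weaken_qual hSt (scopedCtx_nil St) hφ ?_ (hqq.trans h.subset_obs.1) subset_rfl
    h.subset_obs.2
  intro a ha
  obtain ⟨haq, hβ⟩ := Qual.mem_clean.1 ha
  have hβ := hβ rfl
  rcases a with i | l
  · simp [β] at hβ
  · by_contra hn
    obtain ⟨C, r, hl⟩ := hq l haq hn
    simp [β, hl, Ty.isBase] at hβ

/-! ### Closed observations -/

theorem StoreTy.mem_obs {St : StoreTy S} {a : Atom} : a ∈ St.obs ↔ ∃ l ∈ St.dom, a = aloc l := by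
  simp [StoreTy.obs, eq_comm]

theorem StoreTy.obs_subset_domOf (St : StoreTy S) : St.obs ⊆ domOf [] St :=
  St.obs_eq_domAtoms.le

theorem StoreTy.Extends.obs_subset {St St' : StoreTy S} (h : St'.Extends St) :
    St.obs ⊆ St'.obs := Finset.image_subset_image h.dom_subset

theorem mem_withVar_of_subset_obs {St : StoreTy S} {ψ : Qual} (hψ : ψ ⊆ St.obs) {a : Atom}
    (ha : a ∈ ψ.withVar) : a = avar 0 ∨ ∃ l, aloc l ∈ ψ ∧ a = aloc l := by
  refine (Qual.mem_withVar.1 ha).imp_right ?_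
  rintro ⟨b, hb, rfl⟩
  obtain ⟨l, -, rfl⟩ := StoreTy.mem_obs.1 (hψ hb)
  exact ⟨l, hb, rfl⟩

theorem shift_eq_of_subset_obs {St : StoreTy S} {q : Qual} (hq : q ⊆ St.obs) : q.shift = q := by
  have h : ∀ a ∈ q, shiftAtom a = a := by
    intro a ha
    obtain ⟨l, -, rfl⟩ := StoreTy.mem_obs.1 (hq ha)
    rfl
  ext a
  rw [Qual.mem_shift]
  constructor
  · rintro ⟨b, hb, rfl⟩; rwa [h b hb]
  · exact fun ha => ⟨a, ha, h a ha⟩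

theorem StoreTy.Flat.not_reach_nil {St : StoreTy S} (h : St.Flat) {a b : Atom} :
    ¬ Reach [] St a b := by
  intro hr
  rcases a with i | l
  · cases hr with
    | var hi => cases hi
  · exact h.not_reach hr

/-- With no variables bound and only flat entries there are no reachability steps at all. -/
theorem StoreTy.Flat.sat_nil {St : StoreTy S} (h : St.Flat) (q : Qual) :
    sat [] St q = (q : Set Atom) := by
  refine (subset_sat _ _ _).antisymm' ?_
  rintro a ⟨b, hb, hr⟩
  rcases hr.cases_tail with rfl | ⟨c, -, hc⟩
  · exact hb
  · exact (h.not_reach_nil hc).elim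

/-! ### Substitution of a closed value -/

/-- The image `p` of the variable can meet an observable location only inside `p ∩ ψ ⊆ d`, and the
variable is bound with `d`, so it already reaches that location. Reachability in the target is
empty. -/
theorem compat_instQ {St : StoreTy S} (hSt : St.Flat) {T : Ty S} {p d ψ : Qual}
    (hp : p ⊆ St.obs) (hψ : ψ ⊆ St.obs) (hd : p ∩ ψ ⊆ d) :
    Compat [(T, d)] St ψ.withVar [] St (instQ p) := by
  have key : ∀ l, aloc l ∈ ψ → ∀ c ∈ p, c = aloc l →
      Relation.ReflTransGen (Reach [(T, d)] St) (avar 0) (aloc l) := by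
    rintro l hl _ hc rfl
    refine .single (reach_zero_iff.2 ?_)
    exact Qual.shiftAtom_mem_shift (a := aloc l).2 (hd (Finset.mem_inter.2 ⟨hc, hl⟩))
  refine ⟨⟨fun i hi => ?_, subset_rfl⟩, fun a a' b' _ hr => (hSt.not_reach_nil hr).elim,
    fun a ha b hb c hca hcb => ?_⟩
  · obtain rfl : i = 0 := by simpa using hi
    exact hp.trans St.obs_subset_domOf
  · rcases mem_withVar_of_subset_obs hψ ha with rfl | ⟨l, hl, rfl⟩ <;>
    rcases mem_withVar_of_subset_obs hψ hb with rfl | ⟨k, hk, rfl⟩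
    · exact ⟨_, .refl, .refl, hca⟩
    · exact ⟨_, key k hk c hca (Finset.mem_singleton.1 hcb), .refl, hcb⟩
    · exact ⟨_, .refl, key l hl c hcb (Finset.mem_singleton.1 hca), hca⟩
    · rw [Qual.substAtom_inr, Finset.mem_singleton] at hca hcb
      subst hca
      cases hcb
      exact ⟨_, .refl, .refl, Finset.mem_singleton_self _⟩

theorem HasType.inst {St : StoreTy S} {t v : Tm S} {T U : Ty S} {d p q ψ ε : Qual}
    (h : HasType [(T, d)] St ψ.withVar t U q ε) (hSt : St.Flat) (hψ : ψ ⊆ St.obs)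
    (hv : v.IsValue) (hvT : HasType [] St St.obs v T p ∅) (hd : p ∩ ψ ⊆ d) :
    HasType [] St St.obs (Tm.inst v t) (U.subst (instQ p)) (Qual.inst p q) (Qual.inst p ε) := by
  have hp := hvT.subset_obs.1
  rw [Qual.inst_eq_subst, Qual.inst_eq_subst]
  refine h.subst hSt hSt (.refl St) (scopedCtx_nil St) (compat_instQ hSt hp hψ hd) ?_ ?_
    St.obs_subset_domOf
  · intro i T' q' hi
    cases hi with
    | zero =>
      rw [Ty.subst_instQ_shift]
      exact ⟨.inl hv, hvT.of_isAnswer (.inl hv) subset_rfl⟩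
    | succ _ hi => cases hi
  · rw [← Qual.inst_eq_subst]
    exact Qual.inst_subset hp (Qual.withVar_mono hψ)

/-- The body of an abstraction observes only the abstraction's own qualifier, so separation of the
argument from that qualifier suffices. The induction peels off subsumptions around the abstraction.
-/
theorem HasType.lam_inst {Γ : Ctx S} {St : StoreTy S} {φ : Qual} {t₀ : Tm S} {T₀ : Ty S}
    {q ε₀ : Qual} (h : HasType Γ St φ t₀ T₀ q ε₀) (hΓ : Γ = []) (hφ : φ = St.obs) (hSt : St.Flat)
    {t v : Tm S} (ht : t₀ = .lam t) {T U : Ty S} {d r ε p : Qual} (hT : T₀ = .arr T d ε U r)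
    (hv : v.IsValue) (hvT : HasType [] St St.obs v T p ∅) (hd : p ∩ q ⊆ d) :
    HasType [] St St.obs (Tm.inst v t) (U.subst (instQ p)) (Qual.inst p r) (Qual.inst p ε) := by
  induction h generalizing T U d r ε with
  | abs _ _ hb hq =>
    cases ht; cases hT; subst hΓ hφ
    exact hb.inst hSt hq hv hvT hd
  | @sub Γ St φ t₁ T₁ U₁ p₁ q₁ ε₁ ε₂ h₁ hs hq hε ih =>
    subst hΓ hφ hT
    cases hs.1 with
    | @arr _ _ V _ _ W o _ q' _ ε' _ hdom hdomq hcod hcodq heff =>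
      have hp := hvT.subset_obs.1
      -- Only the scoping component is wanted, so the separation data are taken to be empty.
      have hsc : ScopedQ (instQ p) [(T, d)].length St.dom ([] : Ctx S).length St.dom :=
        (compat_instQ (T := T) (d := ∅) (ψ := ∅) hSt hp (Finset.empty_subset _) (by simp)).dom
      have i := ih rfl rfl hSt ht rfl
        (hvT.sub ⟨hdom, ⟨subset_rfl, hp.trans St.obs_subset_domOf⟩, ⟨subset_rfl,
          Finset.empty_subset _⟩⟩ hp (Finset.empty_subset _))
        -- Before subsumption the function's qualifier was smaller and its domain qualifier larger;
        -- both changes help the inclusion.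
        ((Finset.inter_subset_inter_left hs.2.1.1).trans (hd.trans hdomq.1))
      have h1 := hcodq.subst hsc (Δ := [])
      have h2 := heff.subst hsc (Δ := [])
      rw [← Qual.inst_eq_subst, ← Qual.inst_eq_subst] at h1 h2
      refine i.sub ⟨hcod.subst hsc, h1, h2⟩ ?_ ?_
      · rw [St.obs_eq_domAtoms]; exact h1.2
      · rw [St.obs_eq_domAtoms]; exact h2.2
  | _ => cases ht

theorem HasType.app_lam {Γ : Ctx S} {St : StoreTy S} {φ : Qual} {u : Tm S} {T : Ty S}
    {q ε : Qual} (h : HasType Γ St φ u T q ε) (hΓ : Γ = []) (hφ : φ = St.obs) (hSt : St.Flat)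
    {t v : Tm S} (hu : u = .app (.lam t) v) (hv : v.IsValue) :
    HasType [] St St.obs (Tm.inst v t) T q ε := by
  induction h with
  | @app Γ St φ t₁ t₂ T U p q r d ε₁ ε₂ ε₃ ht₁ ht₂ hd hp hq hε hr _ _ =>
    cases hu; subst hΓ hφ
    have i := ht₁.lam_inst rfl rfl hSt rfl rfl hv
      (ht₂.of_isAnswer (.inl hv) ht₂.subset_obs.1) (by
        rw [hSt.sat_nil, hSt.sat_nil, ← Finset.coe_inter, Finset.coe_inj] at hd
        exact hd.ge)
    rw [Ty.subst_instQ_shift] at i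
    exact i.weaken_qual hSt (scopedCtx_nil St) St.obs_subset_domOf subset_rfl i.subset_obs.1
      Finset.subset_union_right (HasType.app ht₁ ht₂ hd hp hq hε hr).subset_obs.2
  | sub _ hs hq hε ih =>
    subst hφ
    exact (ih hΓ rfl hSt hu).sub (hΓ ▸ hs) hq hε
  | _ => cases hu

theorem HasType.letin_value {Γ : Ctx S} {St : StoreTy S} {φ : Qual} {u : Tm S} {T : Ty S}
    {q ε : Qual} (h : HasType Γ St φ u T q ε) (hΓ : Γ = []) (hφ : φ = St.obs) (hSt : St.Flat)
    {t v : Tm S} (hu : u = .letin v t) (hv : v.IsValue) :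
    HasType [] St St.obs (Tm.inst v t) T q ε := by
  induction h with
  | @letin Γ St φ t₁ t₂ T U p q d ε₁ ε₂ ht₁ hd ht₂ _ _ =>
    cases hu; subst hΓ hφ
    have i := ht₂.inst hSt subset_rfl hv (ht₁.of_isAnswer (.inl hv) ht₁.subset_obs.1) (by
        rw [hSt.sat_nil, hSt.sat_nil, ← Finset.coe_inter, Finset.coe_inj] at hd
        exact hd.ge)
    rw [Ty.subst_instQ_shift] at i
    exact i.weaken_qual hSt (scopedCtx_nil St) St.obs_subset_domOf subset_rfl i.subset_obs.1
      Finset.subset_union_right (HasType.letin ht₁ hd ht₂).subset_obs.2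
  | sub _ hs hq hε ih =>
    subst hφ
    exact (ih hΓ rfl hSt hu).sub (hΓ ▸ hs) hq hε
  | _ => cases hu

/-! ### Typing of stores -/

/-- A location has itself in its qualifier and subsumption never removes atoms, so the empty
qualifier excludes locations. Hence stored values are constants, typable under every store typing.
-/
theorem HasType.value_base {Γ : Ctx S} {St : StoreTy S} {φ : Qual} {v : Tm S} {T : Ty S}
    {q ε : Qual} (h : HasType Γ St φ v T q ε) (hv : v.IsValue) {B : S.Base} (hT : T = .base B)
    (hq : q = ∅) : ∃ c, v = .cst c ∧ S.mem c B := by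
  induction h with
  | cst hc => cases hT; exact ⟨_, rfl, hc⟩
  | loc => simp at hq
  | abs => cases hT
  | sub _ hs _ _ ih =>
    subst hT hq
    refine ih hv ?_ (Finset.subset_empty.1 hs.2.1.1)
    cases hs.1; rfl
  | _ => cases hv

theorem HasType.loc_ref {Γ : Ctx S} {St : StoreTy S} {φ : Qual} {v : Tm S} {T : Ty S}
    {q ε : Qual} (h : HasType Γ St φ v T q ε) {l : Loc} (hv : v = .loc l) {B : S.Base}
    (hT : T = .ref B) : ∃ r, St.lookup l = some (.ref B, r) := by
  induction h with
  | loc hl => cases hv; subst hT; exact ⟨_, hl⟩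
  | sub _ hs _ _ ih =>
    subst hT
    refine ih hv ?_
    cases hs.1; rfl
  | _ => cases hv

/-- The store `σ` has the flat store typing `St`, and its cells hold constants. -/
structure Consistent (St : StoreTy S) (σ : Store S) : Prop where
  flat : St.Flat
  dom : ∀ l, l ∈ σ.dom ↔ l ∈ St.dom
  cell : ∀ l v, (l, Entry.cell v) ∈ σ →
    ∃ B c, St.lookup l = some (.ref B, ∅) ∧ v = .cst c ∧ S.mem c B

theorem StoreTy.extends_insert {St : StoreTy S} {l : Loc} {b : Ty S × Qual} (hl : l ∉ St.dom) :
    StoreTy.Extends (St.insert l b) St := by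
  intro k c hk
  rw [Finmap.lookup_insert_of_ne, hk]
  rintro rfl
  exact hl (StoreTy.mem_dom.2 ⟨c, hk⟩)

theorem StoreTy.mem_dom_insert {St : StoreTy S} {l k : Loc} {b : Ty S × Qual} :
    k ∈ StoreTy.dom (St.insert l b) ↔ k = l ∨ k ∈ St.dom := by
  simp only [StoreTy.dom, Finmap.mem_keys, Finmap.mem_insert]

theorem Consistent.alloc {St : StoreTy S} {σ : Store S} (h : Consistent St σ) {l : Loc}
    (hl : l ∉ St.dom) {c : S.Const} {B : S.Base} (hc : S.mem c B) :
    Consistent (St.insert l (Ty.ref B, ∅)) (σ ++ [(l, .cell (.cst c))]) := by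
  refine ⟨fun k T q hk => ?_, fun k => ?_, fun k v hk => ?_⟩
  · by_cases hkl : k = l
    · subst hkl
      rw [Finmap.lookup_insert, Option.some_inj] at hk
      cases hk
      exact ⟨rfl, .inr ⟨B, rfl⟩⟩
    · rw [Finmap.lookup_insert_of_ne _ hkl] at hk
      exact h.flat _ _ _ hk
  · rw [StoreTy.mem_dom_insert, ← h.dom]
    simp [Store.dom, or_comm]
  · rw [List.mem_append, List.mem_singleton] at hk
    rcases hk with hk | hk
    · obtain ⟨B', c', h1, h2⟩ := h.cell k v hk
      exact ⟨B', c', StoreTy.extends_insert hl _ _ h1, h2⟩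
    · cases hk
      exact ⟨B, c, Finmap.lookup_insert _, rfl, hc⟩

theorem WfStore.consistent {Γ : Ctx S} {φ : Qual} {St : StoreTy S} {σ : Store S}
    (h : WfStore Γ φ St σ) : Consistent St σ := by
  induction h with
  | empty =>
    refine ⟨fun l T q hl => ?_, fun l => ?_, fun l v hl => by cases hl⟩
    · simp at hl
    · simp [Store.dom, StoreTy.dom]
  | init w =>
    refine ⟨fun l T q hl => ?_, fun l => ?_, fun l v hl => by simp at hl⟩
    · by_cases hlw : l = w
      · subst hlw
        rw [Finmap.lookup_singleton_eq, Option.some_inj] at hl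
        cases hl
        exact ⟨rfl, .inl ⟨_, rfl⟩⟩
      · have : l ∈ StoreTy.dom (Finmap.singleton w (Ty.base S.allocTy, ∅)) :=
          StoreTy.mem_dom.2 ⟨_, hl⟩
        rw [StoreTy.dom, Finmap.mem_keys, Finmap.mem_singleton] at this
        exact (hlw this).elim
    · rw [StoreTy.dom, Finmap.mem_keys, Finmap.mem_singleton]
      simp [Store.dom]
  | alloc _ hval hv hl ih =>
    obtain ⟨c, rfl, hc⟩ := hv.value_base hval rfl rfl
    exact ih.alloc hl hc

/-! ### Growth of the store -/

/-- `St'` extends `St` by the locations in `F`, which have reference types. -/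
structure Grows (St St' : StoreTy S) (F : Qual) : Prop where
  flat : St.Flat
  flat' : St'.Flat
  ext : St'.Extends St
  subset : F ⊆ St'.obs
  disj : Disjoint F St.obs
  ref : ∀ l, aloc l ∈ F → ∃ C r, St'.lookup l = some (.ref C, r)

theorem Grows.refl {St : StoreTy S} (h : St.Flat) : Grows St St ∅ :=
  ⟨h, h, .refl St, Finset.empty_subset _, Finset.disjoint_empty_left _, by simp⟩

/-- Extend the qualifier of the innermost variable by `F`. -/
def growQ (F : Qual) : ℕ → Qual
  | 0 => insert (avar 0) F
  | i + 1 => {avar (i + 1)}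

/-- In the new context the variable reaches `F`, which nothing old reaches. Putting `F` into the
image of the variable accounts for this, and freshness keeps that image away from every old
location. -/
theorem compat_growQ {St St' : StoreTy S} {F : Qual} (h : Grows St St' F) {T : Ty S} {d : Qual}
    (hd : d ⊆ St.obs) :
    Compat [(T, d)] St St.obs.withVar [(T, d ∪ F)] St' (growQ F) := by
  have hdF : d ∪ F ⊆ St'.obs := Finset.union_subset (hd.trans h.ext.obs_subset) h.subset
  have hF : ∀ l, aloc l ∈ St.obs → aloc l ∉ Qual.substAtom (growQ F) (avar 0) := by
    intro l hl hlF
    rw [Qual.substAtom_inl, growQ, Finset.mem_insert] at hlF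
    rcases hlF with hlF | hlF
    · cases hlF
    · exact Finset.disjoint_left.1 h.disj hlF hl
  have hl1 : ∀ b : Atom, b ∈ F → ∃ l, b = aloc l := fun b hb =>
    let ⟨l, _, e⟩ := StoreTy.mem_obs.1 (h.subset hb); ⟨l, e⟩
  refine ⟨⟨fun i hi => ?_, h.ext.dom_subset⟩, fun a a' b' ha' hr => ?_,
    fun a ha b hb c hca hcb => ?_⟩
  · obtain rfl : i = 0 := by simpa using hi
    refine Finset.insert_subset (by simp) fun a ha => ?_
    obtain ⟨l, hl, rfl⟩ := StoreTy.mem_obs.1 (h.subset ha)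
    exact aloc_mem_domAtoms.2 hl
  · have hz : a' = avar 0 → ∃ b, Relation.ReflTransGen (Reach [(T, d)] St) (avar 0) b ∧
        b' ∈ Qual.substAtom (growQ F) b := by
      rintro rfl
      have hb := reach_zero_iff.1 hr
      rw [shift_eq_of_subset_obs hdF, Finset.mem_union] at hb
      rcases hb with hb | hb
      · obtain ⟨l, -, rfl⟩ := StoreTy.mem_obs.1 (hd hb)
        refine ⟨aloc l, .single (reach_zero_iff.2 ?_), Finset.mem_singleton_self _⟩
        rwa [shift_eq_of_subset_obs hd]
      · exact ⟨_, .refl, Finset.mem_insert_of_mem hb⟩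
    rcases a' with (_ | i) | l
    · rcases a with (_ | j) | k
      · exact hz rfl
      · simp [growQ] at ha'
      · simp at ha'
    · cases hr with
      | var hi =>
        cases hi with
        | succ _ hi => cases hi
    · exact (h.flat'.not_reach hr).elim
  · rcases mem_withVar_of_subset_obs subset_rfl ha with rfl | ⟨l, hl, rfl⟩ <;>
    rcases mem_withVar_of_subset_obs subset_rfl hb with rfl | ⟨k, hk, rfl⟩
    · exact ⟨_, .refl, .refl, hca⟩
    · rw [Qual.substAtom_inr, Finset.mem_singleton] at hcb
      subst hcb
      exact (hF _ hk hca).elim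
    · rw [Qual.substAtom_inr, Finset.mem_singleton] at hca
      subst hca
      exact (hF _ hl hcb).elim
    · rw [Qual.substAtom_inr, Finset.mem_singleton] at hca hcb
      subst hca
      cases hcb
      exact ⟨_, .refl, .refl, Finset.mem_singleton_self _⟩

theorem HasType.grow {St St' : StoreTy S} {F : Qual} (hG : Grows St St' F) {t : Tm S}
    {T U : Ty S} {d q ε : Qual} (h : HasType [(T, d)] St St.obs.withVar t U.shift q ε)
    (hd : d ⊆ St.obs) (hT : T.Scoped 0 St'.dom) :
    HasType [(T, d ∪ F)] St' St'.obs.withVar t U.shift (q.subst (growQ F))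
      (ε.subst (growQ F)) := by
  have hdF : d ∪ F ⊆ St'.obs := Finset.union_subset (hd.trans hG.ext.obs_subset) hG.subset
  have hΔ : ScopedCtx [(T, d ∪ F)] St' :=
    (scopedCtx_nil St').cons hT (hdF.trans St'.obs_subset_domOf)
  have hsh : ∀ V : Ty S, V.shift.subst (growQ F) = V.shift := fun V => by
    rw [Ty.subst_shift, Ty.shift_eq_subst]; rfl
  have hle : growQ F 0 ⊆ St'.obs.withVar := by
    refine Finset.insert_subset Qual.zero_mem_withVar (hG.subset.trans ?_)
    conv_lhs => rw [← shift_eq_of_subset_obs (St := St') subset_rfl]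
    exact Finset.subset_insert _ _
  have hobs' : St'.obs.withVar ⊆ domOf [(T, d ∪ F)] St' :=
    withVar_subset_domAtoms St'.obs_subset_domOf
  have := h.subst (φ' := St'.obs.withVar) (s := Tm.var) hG.flat hG.flat' hG.ext hΔ
    (compat_growQ hG hd) ?_ ?_ hobs'
  · rwa [Tm.subst_var, hsh] at this
  · intro i V q' hi
    cases hi with
    | zero =>
      rw [hsh]
      refine ⟨.inr ⟨0, rfl⟩, ?_⟩
      -- The term is unchanged: the variable stands for itself, with its qualifier enlarged by `F`
      -- through subsumption.
      exact (HasType.var (.zero ..) (Finset.mem_insert_self _ _)).weaken_qual hG.flat' hΔ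
        (hle.trans hobs') (Finset.singleton_subset_iff.2 (Finset.mem_insert_self _ _)) subset_rfl
        subset_rfl (Finset.empty_subset _)
    | succ _ hi => cases hi
  · intro a ha
    obtain ⟨b, hb, hab⟩ := Qual.mem_subst.1 ha
    rcases mem_withVar_of_subset_obs subset_rfl hb with rfl | ⟨l, hl, rfl⟩
    · exact hle hab
    · rw [Qual.substAtom_inr, Finset.mem_singleton] at hab
      subst hab
      exact Qual.withVar_mono hG.ext.obs_subset hb

/-- The growth of the body's qualifier and that of the bound term add the same set `F`, so together
they still contribute only `F`. -/
theorem inst_growQ_subset {St St' : StoreTy S} {F : Qual} (hG : Grows St St' F) {p q : Qual}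
    (hq : q ⊆ St.obs.withVar) :
    Qual.inst (p ∪ F) (q.subst (growQ F)) ⊆ Qual.inst p q ∪ F := by
  intro a ha
  rw [Finset.mem_union, Qual.mem_inst]
  by_cases haF : a ∈ F
  · exact .inr haF
  left
  rcases Qual.mem_inst.1 ha with ⟨hap, h0⟩ | ha
  · rw [Finset.mem_union, or_iff_left haF] at hap
    refine .inl ⟨hap, ?_⟩
    obtain ⟨b, hb, h0b⟩ := Qual.mem_subst.1 h0
    rcases mem_withVar_of_subset_obs subset_rfl (hq hb) with rfl | ⟨l, hl, rfl⟩
    · exact hb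
    · simp at h0b
  · obtain ⟨b, hb, hab⟩ := Qual.mem_subst.1 ha
    rcases mem_withVar_of_subset_obs subset_rfl (hq hb) with rfl | ⟨l, hl, rfl⟩
    · rw [Qual.substAtom_inl, growQ, Finset.mem_insert,
        or_iff_right (Qual.shiftAtom_ne_zero a)] at hab
      obtain ⟨l, -, e⟩ := StoreTy.mem_obs.1 (hG.subset hab)
      obtain rfl : a = aloc l := Qual.shiftAtom_injective e
      exact (haF hab).elim
    · rw [Qual.substAtom_inr, Finset.mem_singleton] at hab
      exact .inr (hab ▸ hb)

/-! ### Evaluation contexts -/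

theorem Grows.subset_obs {St St' : StoreTy S} {F : Qual} (hG : Grows St St' F) {q : Qual}
    (hq : q ⊆ St.obs) : q ∪ F ⊆ St'.obs :=
  Finset.union_subset (hq.trans hG.ext.obs_subset) hG.subset

theorem Grows.weaken {St St' : StoreTy S} {F : Qual} (hG : Grows St St' F) {t : Tm S} {T : Ty S}
    {q ε : Qual} (h : HasType [] St St.obs t T q ε) : HasType [] St' St'.obs t T q ε :=
  h.weaken_store hG.flat hG.flat' hG.ext

/-- New locations cannot meet an old qualifier. This is what preserves separation, both within
applications and in the final theorem. -/
theorem Grows.inter_union {St St' : StoreTy S} {F : Qual} (hG : Grows St St' F) {p q : Qual}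
    (hp : p ⊆ St.obs) : p ∩ (q ∪ F) = p ∩ q := by
  rw [Finset.inter_union_distrib_left,
    Finset.disjoint_iff_inter_eq_empty.1 (hG.disj.symm.mono_left hp), Finset.union_empty]

theorem inst_union_subset (p q F : Qual) : Qual.inst (p ∪ F) q ⊆ Qual.inst p q ∪ F := by
  intro a
  simp only [Qual.mem_inst, Finset.mem_union]
  tauto

/-- Allocation and assignment demand the empty qualifier for the stored term. New locations have
reference type, so a base-type term can give them up again. -/
theorem Grows.restrict_base {St St' : StoreTy S} {F : Qual} (hG : Grows St St' F) {t : Tm S}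
    {B : S.Base} {ε : Qual} (h : HasType [] St' St'.obs t (.base B) (∅ ∪ F) ε) :
    HasType [] St' St'.obs t (.base B) ∅ ε :=
  h.restrict_base hG.flat' (Finset.empty_subset _) fun l hl _ =>
    hG.ref l (by rwa [Finset.empty_union] at hl)

theorem HasType.widen {St : StoreTy S} {t : Tm S} {T : Ty S} {q q' ε ε' : Qual}
    (h : HasType [] St St.obs t T q ε) (hSt : St.Flat) (hq : q ⊆ q') (hq' : q' ⊆ St.obs)
    (hε : ε ⊆ ε') (hε' : ε' ⊆ St.obs) : HasType [] St St.obs t T q' ε' :=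
  h.weaken_qual hSt (scopedCtx_nil St) St.obs_subset_domOf hq hq' hε hε'

theorem HasType.app_closed {St : StoreTy S} {t₁ t₂ : Tm S} {T U : Ty S}
    {p q r d ε₁ ε₂ ε₃ q' ε' : Qual} (hSt : St.Flat)
    (ht₁ : HasType [] St St.obs t₁ (.arr T d ε₃ U.shift r) q ε₁)
    (ht₂ : HasType [] St St.obs t₂ T p ε₂) (hd : p ∩ q ⊆ d)
    (hε : ε₃ ⊆ q.withVar) (hr : r ⊆ St.obs.withVar) (hq' : Qual.inst p r ⊆ q')
    (hq'' : q' ⊆ St.obs) (hε' : ε₁ ∪ ε₂ ∪ Qual.inst p ε₃ ⊆ ε') (hε'' : ε' ⊆ St.obs) :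
    HasType [] St St.obs (.app t₁ t₂) U q' ε' := by
  refine ht₁.app_of_subset hSt (scopedCtx_nil St) St.obs_subset_domOf ht₂ ?_ ?_ ?_ hε hr hq' hq''
    hε' hε''
  · rw [hSt.sat_nil, hSt.sat_nil]; exact_mod_cast hd
  · rw [hSt.sat_nil]; exact Finset.coe_subset.2 ht₂.subset_obs.1
  · rw [hSt.sat_nil]; exact Finset.coe_subset.2 ht₁.subset_obs.1

/-- A closed term `u` in the hole of `E` is typable, and it may be replaced by a term whose qualifier
and effect have grown by newly allocated locations; then `E[u]`, of type `T`, qualifier `q` and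
effect `ε`, grows in the same way. -/
def Replaceable (St : StoreTy S) (E : ECtx S) (u : Tm S) (T : Ty S) (q ε : Qual) : Prop :=
  ∃ Tu qu εu, HasType [] St St.obs u Tu qu εu ∧ ∀ St' F u', Grows St St' F →
    HasType [] St' St'.obs u' Tu (qu ∪ F) (εu ∪ F) →
    HasType [] St' St'.obs (E.plug u') T (q ∪ F) (ε ∪ F)

namespace Replaceable

variable {St : StoreTy S} {E : ECtx S} {u t t₁ t₂ : Tm S} {T U : Ty S} {B : S.Base}
  {p q d r ε ε₁ ε₂ ε₃ : Qual}

theorem hole (h : HasType [] St St.obs u T q ε) : Replaceable St .hole u T q ε :=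
  ⟨T, q, ε, h, fun _ _ _ _ h => h⟩

/-- The function's qualifier grows by locations that the argument cannot mention, so their overlap,
and with it the domain condition, is unchanged. -/
theorem appL (h : Replaceable St E u (.arr T d ε₃ U.shift r) q ε₁)
    (ht₂ : HasType [] St St.obs t₂ T p ε₂) (hd : p ∩ q ⊆ d)
    (hε : ε₃ ⊆ q.withVar) (hr : r ⊆ St.obs.withVar) (hq : Qual.inst p r ⊆ St.obs)
    (hε' : ε₁ ∪ ε₂ ∪ Qual.inst p ε₃ ⊆ St.obs) :
    Replaceable St (.appL E t₂) u U (Qual.inst p r) (ε₁ ∪ ε₂ ∪ Qual.inst p ε₃) := by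
  obtain ⟨Tu, qu, εu, hu, H⟩ := h
  refine ⟨Tu, qu, εu, hu, fun St' F u' hG hu' => ?_⟩
  refine (H St' F u' hG hu').app_closed hG.flat' (hG.weaken ht₂)
    ((hG.inter_union ht₂.subset_obs.1).le.trans hd)
    (hε.trans (Qual.withVar_mono Finset.subset_union_left))
    (hr.trans (Qual.withVar_mono hG.ext.obs_subset)) Finset.subset_union_left
    (hG.subset_obs hq) ?_ (hG.subset_obs hε')
  rw [Finset.union_right_comm ε₁ F, Finset.union_right_comm _ F]

theorem appR {v : Tm S} (hv : v.IsValue) (h : Replaceable St E u T p ε₂)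
    (ht₁ : HasType [] St St.obs v (.arr T d ε₃ U.shift r) q ε₁) (hd : p ∩ q ⊆ d)
    (hε : ε₃ ⊆ q.withVar) (hr : r ⊆ St.obs.withVar) (hq : Qual.inst p r ⊆ St.obs)
    (hε' : ε₁ ∪ ε₂ ∪ Qual.inst p ε₃ ⊆ St.obs) :
    Replaceable St (.appR v hv E) u U (Qual.inst p r) (ε₁ ∪ ε₂ ∪ Qual.inst p ε₃) := by
  obtain ⟨Tu, qu, εu, hu, H⟩ := h
  refine ⟨Tu, qu, εu, hu, fun St' F u' hG hu' => ?_⟩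
  refine (hG.weaken ht₁).app_closed hG.flat' (H St' F u' hG hu') ?_ hε
    (hr.trans (Qual.withVar_mono hG.ext.obs_subset)) (inst_union_subset ..)
    (hG.subset_obs hq) ?_ (hG.subset_obs hε')
  · rw [Finset.inter_comm, hG.inter_union ht₁.subset_obs.1, Finset.inter_comm]
    exact hd
  · rw [← Finset.union_assoc ε₁, Finset.union_assoc _ F]
    rw [Finset.union_assoc (ε₁ ∪ ε₂) _ F]
    exact Finset.union_subset_union subset_rfl
      (Finset.union_subset Finset.subset_union_right (inst_union_subset ..))

/-- The bound term's new qualifier changes the assumption on the variable, so the body is retyped by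
`HasType.grow`. -/
theorem letin (h : Replaceable St E u T p ε₁) (hp : p ⊆ St.obs)
    (ht₂ : HasType [(T, p)] St St.obs.withVar t₂ U.shift q ε₂) (hq : Qual.inst p q ⊆ St.obs)
    (hε : ε₁ ∪ Qual.inst p ε₂ ⊆ St.obs) :
    Replaceable St (.letin E t₂) u U (Qual.inst p q) (ε₁ ∪ Qual.inst p ε₂) := by
  obtain ⟨Tu, qu, εu, hu, H⟩ := h
  refine ⟨Tu, qu, εu, hu, fun St' F u' hG hu' => ?_⟩
  have h₁ := H St' F u' hG hu'
  have hs₂ := ht₂.subset_obs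
  refine h₁.letin_of_subset hG.flat' (scopedCtx_nil St') St'.obs_subset_domOf
    (hG.flat'.sat_nil _).symm (ht₂.grow hG hp ?_) (inst_growQ_subset hG hs₂.1)
    (hG.subset_obs hq) ?_ (hG.subset_obs hε)
  · exact h₁.scoped hG.flat' (scopedCtx_nil St') St'.obs_subset_domOf
  · rw [Finset.union_assoc ε₁, Finset.union_assoc ε₁]
    exact Finset.union_subset_union subset_rfl
      (Finset.union_subset Finset.subset_union_right (inst_growQ_subset hG hs₂.2))

theorem deref (h : Replaceable St E u (.ref B) q ε) (hε : ε ∪ q ⊆ St.obs) :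
    Replaceable St (.deref E) u (.base B) ∅ (ε ∪ q) := by
  obtain ⟨Tu, qu, εu, hu, H⟩ := h
  refine ⟨Tu, qu, εu, hu, fun St' F u' hG hu' => ?_⟩
  refine (HasType.deref (H St' F u' hG hu')).widen hG.flat' (Finset.empty_subset _)
    (hG.subset_obs (Finset.empty_subset _)) ?_ (hG.subset_obs hε)
  rw [← Finset.union_union_distrib_right]

theorem refL (h : Replaceable St E u (.base S.allocTy) q ε₁)
    (ht₂ : HasType [] St St.obs t₂ (.base B) ∅ ε₂) (hε : ε₁ ∪ ε₂ ∪ q ⊆ St.obs) :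
    Replaceable St (.refL E t₂) u (.ref B) ∅ (ε₁ ∪ ε₂ ∪ q) := by
  obtain ⟨Tu, qu, εu, hu, H⟩ := h
  refine ⟨Tu, qu, εu, hu, fun St' F u' hG hu' => ?_⟩
  refine (HasType.ref (H St' F u' hG hu') (hG.weaken ht₂)).widen hG.flat'
    (Finset.empty_subset _) (hG.subset_obs (Finset.empty_subset _)) ?_ (hG.subset_obs hε)
  rw [Finset.union_right_comm ε₁ F, ← Finset.union_union_distrib_right]

theorem refR {v : Tm S} (hv : v.IsValue) (h : Replaceable St E u (.base B) ∅ ε₂)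
    (ht₁ : HasType [] St St.obs v (.base S.allocTy) q ε₁) (hε : ε₁ ∪ ε₂ ∪ q ⊆ St.obs) :
    Replaceable St (.refR v hv E) u (.ref B) ∅ (ε₁ ∪ ε₂ ∪ q) := by
  obtain ⟨Tu, qu, εu, hu, H⟩ := h
  refine ⟨Tu, qu, εu, hu, fun St' F u' hG hu' => ?_⟩
  refine (HasType.ref (hG.weaken ht₁) (hG.restrict_base (H St' F u' hG hu'))).widen hG.flat'
    (Finset.empty_subset _) (hG.subset_obs (Finset.empty_subset _)) ?_ (hG.subset_obs hε)
  rw [← Finset.union_assoc ε₁, Finset.union_right_comm _ F]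

theorem assignL (h : Replaceable St E u (.ref B) q ε₁)
    (ht₂ : HasType [] St St.obs t₂ (.base B) ∅ ε₂) (hε : ε₁ ∪ ε₂ ∪ q ⊆ St.obs) :
    Replaceable St (.assignL E t₂) u (.base S.unitTy) ∅ (ε₁ ∪ ε₂ ∪ q) := by
  obtain ⟨Tu, qu, εu, hu, H⟩ := h
  refine ⟨Tu, qu, εu, hu, fun St' F u' hG hu' => ?_⟩
  refine (HasType.assign (H St' F u' hG hu') (hG.weaken ht₂)).widen hG.flat'
    (Finset.empty_subset _) (hG.subset_obs (Finset.empty_subset _)) ?_ (hG.subset_obs hε)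
  rw [Finset.union_right_comm ε₁ F, ← Finset.union_union_distrib_right]

theorem assignR {v : Tm S} (hv : v.IsValue) (h : Replaceable St E u (.base B) ∅ ε₂)
    (ht₁ : HasType [] St St.obs v (.ref B) q ε₁) (hε : ε₁ ∪ ε₂ ∪ q ⊆ St.obs) :
    Replaceable St (.assignR v hv E) u (.base S.unitTy) ∅ (ε₁ ∪ ε₂ ∪ q) := by
  obtain ⟨Tu, qu, εu, hu, H⟩ := h
  refine ⟨Tu, qu, εu, hu, fun St' F u' hG hu' => ?_⟩
  refine (HasType.assign (hG.weaken ht₁) (hG.restrict_base (H St' F u' hG hu'))).widen hG.flat'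
    (Finset.empty_subset _) (hG.subset_obs (Finset.empty_subset _)) ?_ (hG.subset_obs hε)
  rw [← Finset.union_assoc ε₁, Finset.union_right_comm _ F]

theorem sub (h : Replaceable St E u T p ε₁) (hs : SubQ [] St T p ε₁ U q ε₂) (hq : q ⊆ St.obs)
    (hε : ε₂ ⊆ St.obs) : Replaceable St E u U q ε₂ := by
  obtain ⟨Tu, qu, εu, hu, H⟩ := h
  refine ⟨Tu, qu, εu, hu, fun St' F u' hG hu' => ?_⟩
  have hq' := hG.subset_obs hq
  have hε' := hG.subset_obs hε
  refine (H St' F u' hG hu').sub ⟨?_, ⟨Finset.union_subset_union_left hs.2.1.1,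
    hq'.trans St'.obs_subset_domOf⟩, ⟨Finset.union_subset_union_left hs.2.2.1,
    hε'.trans St'.obs_subset_domOf⟩⟩ hq' hε'
  have := hs.1.subst (Δ := []) (St' := St') (θ := renQ id) ⟨by simp, hG.ext.dom_subset⟩
  rwa [Ty.subst_renQ_id, Ty.subst_renQ_id] at this

end Replaceable

/-- The induction is on the derivation, not on the context, since subsumption may intervene at every
frame around the hole. -/
theorem HasType.replaceable {Γ : Ctx S} {St : StoreTy S} {φ : Qual} {t : Tm S} {T : Ty S}
    {q ε : Qual} (h : HasType Γ St φ t T q ε) (hΓ : Γ = []) (hφ : φ = St.obs) (hSt : St.Flat)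
    {E : ECtx S} {u : Tm S} (ht : t = E.plug u) : Replaceable St E u T q ε := by
  induction h generalizing E with
  | @app Γ St φ t₁ t₂ T U p q r d ε₁ ε₂ ε₃ ht₁ ht₂ hd hp hq hε hr ih₁ ih₂ =>
    subst hΓ hφ
    have h := HasType.app ht₁ ht₂ hd hp hq hε hr
    rw [hSt.sat_nil, hSt.sat_nil, ← Finset.coe_inter, Finset.coe_inj] at hd
    obtain ⟨hs, hs'⟩ := h.subset_obs
    cases E with
    | hole => subst ht; exact .hole h
    | appL E t => cases ht; exact (ih₁ rfl rfl hSt rfl).appL ht₂ hd.ge hε hr hs hs'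
    | appR v hv E => cases ht; exact (ih₂ rfl rfl hSt rfl).appR hv ht₁ hd.ge hε hr hs hs'
    | _ => cases ht
  | @letin Γ St φ t₁ t₂ T U p q d ε₁ ε₂ ht₁ hd ht₂ ih₁ _ =>
    subst hΓ hφ
    have h := HasType.letin ht₁ hd ht₂
    obtain rfl : d = p := by
      rw [hSt.sat_nil, hSt.sat_nil, ← Finset.coe_inter, Finset.coe_inj] at hd
      rw [hd, Finset.inter_eq_left.2 ht₁.subset_obs.1]
    obtain ⟨hs, hs'⟩ := h.subset_obs
    cases E with
    | hole => subst ht; exact .hole h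
    | letin E t => cases ht; exact (ih₁ rfl rfl hSt rfl).letin ht₁.subset_obs.1 ht₂ hs hs'
    | _ => cases ht
  | ref ht₁ ht₂ ih₁ ih₂ =>
    subst hΓ hφ
    have h := HasType.ref ht₁ ht₂
    cases E with
    | hole => subst ht; exact .hole h
    | refL E t => cases ht; exact (ih₁ rfl rfl hSt rfl).refL ht₂ h.subset_obs.2
    | refR v hv E => cases ht; exact (ih₂ rfl rfl hSt rfl).refR hv ht₁ h.subset_obs.2
    | _ => cases ht
  | assign ht₁ ht₂ ih₁ ih₂ =>
    subst hΓ hφ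
    have h := HasType.assign ht₁ ht₂
    cases E with
    | hole => subst ht; exact .hole h
    | assignL E t => cases ht; exact (ih₁ rfl rfl hSt rfl).assignL ht₂ h.subset_obs.2
    | assignR v hv E => cases ht; exact (ih₂ rfl rfl hSt rfl).assignR hv ht₁ h.subset_obs.2
    | _ => cases ht
  | deref ht₁ ih =>
    subst hΓ hφ
    have h := HasType.deref ht₁
    cases E with
    | hole => subst ht; exact .hole h
    | deref E => cases ht; exact (ih rfl rfl hSt rfl).deref h.subset_obs.2
    | _ => cases ht
  | sub _ hs hq hε ih =>
    subst hΓ hφ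
    exact (ih rfl rfl hSt ht).sub hs hq hε
  | cst hc =>
    subst hΓ hφ
    cases E with
    | hole => subst ht; exact .hole (.cst hc)
    | _ => cases ht
  | var hx hv =>
    subst hΓ hφ
    cases E with
    | hole => subst ht; exact .hole (.var hx hv)
    | _ => cases ht
  | loc hl hv =>
    subst hΓ hφ
    cases E with
    | hole => subst ht; exact .hole (.loc hl hv)
    | _ => cases ht
  | abs hT hp hb hq =>
    subst hΓ hφ
    cases E with
    | hole => subst ht; exact .hole (.abs hT hp hb hq)
    | _ => cases ht

/-! ### Preservation -/

theorem HasType.inv_ref {Γ : Ctx S} {St : StoreTy S} {φ : Qual} {u : Tm S} {T : Ty S}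
    {q ε : Qual} (h : HasType Γ St φ u T q ε) {a v : Tm S} (hu : u = .ref a v) :
    ∃ B ε', T = .ref B ∧ HasType Γ St φ v (.base B) ∅ ε' := by
  induction h with
  | ref _ ht₂ => cases hu; exact ⟨_, _, rfl, ht₂⟩
  | sub _ hs _ _ ih =>
    obtain ⟨B, ε', rfl, h⟩ := ih hu
    cases hs.1
    exact ⟨B, ε', rfl, h⟩
  | _ => cases hu

theorem HasType.inv_deref {Γ : Ctx S} {St : StoreTy S} {φ : Qual} {u : Tm S} {T : Ty S}
    {q ε : Qual} (h : HasType Γ St φ u T q ε) {t : Tm S} (hu : u = .deref t) :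
    ∃ B q' ε', T = .base B ∧ HasType Γ St φ t (.ref B) q' ε' := by
  induction h with
  | deref ht => cases hu; exact ⟨_, _, _, rfl, ht⟩
  | sub _ hs _ _ ih =>
    obtain ⟨B, q', ε', rfl, h⟩ := ih hu
    cases hs.1
    exact ⟨B, q', ε', rfl, h⟩
  | _ => cases hu

theorem HasType.inv_assign {Γ : Ctx S} {St : StoreTy S} {φ : Qual} {u : Tm S} {T : Ty S}
    {q ε : Qual} (h : HasType Γ St φ u T q ε) {t₁ t₂ : Tm S} (hu : u = .assign t₁ t₂) :
    ∃ B q' ε₁ ε₂, T = .base S.unitTy ∧ HasType Γ St φ t₁ (.ref B) q' ε₁ ∧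
      HasType Γ St φ t₂ (.base B) ∅ ε₂ := by
  induction h with
  | assign ht₁ ht₂ => cases hu; exact ⟨_, _, _, _, rfl, ht₁, ht₂⟩
  | sub _ hs _ _ ih =>
    obtain ⟨B, q', ε₁, ε₂, rfl, h⟩ := ih hu
    cases hs.1
    exact ⟨B, q', ε₁, ε₂, rfl, h⟩
  | _ => cases hu

theorem HasType.plug_replace {St : StoreTy S} {E : ECtx S} {u u' : Tm S} {T : Ty S} {q ε : Qual}
    (h : HasType [] St St.obs (E.plug u) T q ε) (hSt : St.Flat)
    (hu : ∀ Tu qu εu, HasType [] St St.obs u Tu qu εu → HasType [] St St.obs u' Tu qu εu) :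
    HasType [] St St.obs (E.plug u') T q ε := by
  obtain ⟨Tu, qu, εu, h₁, H⟩ := h.replaceable rfl rfl hSt rfl
  have := H St ∅ u' (.refl hSt)
  simp only [Finset.union_empty] at this
  exact this (hu _ _ _ h₁)

theorem Consistent.cell_of_loc {St : StoreTy S} {σ₁ σ₂ : Store S} {l : Loc} {v : Tm S}
    (h : Consistent St (σ₁ ++ (l, .cell v) :: σ₂)) {B : S.Base} {q ε : Qual}
    (ht : HasType [] St St.obs (.loc l) (.ref B) q ε) :
    St.lookup l = some (.ref B, ∅) ∧ ∃ c, v = .cst c ∧ S.mem c B := by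
  obtain ⟨C, c, h1, h2, h3⟩ := h.cell l v (by simp)
  obtain ⟨r, hr⟩ := ht.loc_ref rfl rfl
  rw [h1, Option.some_inj] at hr
  cases hr
  exact ⟨h1, c, h2, h3⟩

/-- Preservation: reduction preserves types, and qualifiers grow only by newly allocated
locations. -/
theorem Step.preservation {σ σ' : Store S} {t t' : Tm S} (hstep : Step σ t σ' t')
    {St : StoreTy S} (hσ : Consistent St σ) {T : Ty S} {q ε : Qual}
    (ht : HasType [] St St.obs t T q ε) :
    ∃ St' F, Grows St St' F ∧ Consistent St' σ' ∧
      HasType [] St' St'.obs t' T (q ∪ F) (ε ∪ F) := by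
  have hSt := hσ.flat
  cases hstep with
  | beta _ E t v hv =>
    refine ⟨St, ∅, .refl hSt, hσ, ?_⟩
    simp only [Finset.union_empty]
    exact ht.plug_replace hSt fun _ _ _ h => h.app_lam rfl rfl hSt rfl hv
  | letin _ E v t hv =>
    refine ⟨St, ∅, .refl hSt, hσ, ?_⟩
    simp only [Finset.union_empty]
    exact ht.plug_replace hSt fun _ _ _ h => h.letin_value rfl rfl hSt rfl hv
  | ref _ E a v l ha hv hl =>
    obtain ⟨Tu, qu, εu, hu, H⟩ := ht.replaceable rfl rfl hSt rfl
    obtain ⟨B, ε', rfl, hv'⟩ := hu.inv_ref rfl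
    obtain ⟨c, rfl, hc⟩ := hv'.value_base hv rfl rfl
    have hl' : l ∉ St.dom := fun h => hl ((hσ.dom l).2 h)
    have hσ' := hσ.alloc hl' hc
    have hmem : aloc l ∈ StoreTy.obs (St.insert l (Ty.ref B, ∅)) :=
      StoreTy.mem_obs.2 ⟨l, StoreTy.mem_dom_insert.2 (.inl rfl), rfl⟩
    -- Only allocation has a nonempty growth set, namely the new location, which has reference type
    -- as required.
    have hG : Grows St (St.insert l (Ty.ref B, ∅)) {aloc l} := by
      refine ⟨hSt, hσ'.flat, StoreTy.extends_insert hl', Finset.singleton_subset_iff.2 hmem,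
        Finset.disjoint_singleton_left.2 fun h => ?_, fun k hk => ?_⟩
      · obtain ⟨k, hk, e⟩ := StoreTy.mem_obs.1 h
        cases e
        exact hl' hk
      · rw [Finset.mem_singleton] at hk
        cases hk
        exact ⟨B, ∅, Finmap.lookup_insert _⟩
    refine ⟨_, _, hG, hσ', H _ _ _ hG ?_⟩
    exact (HasType.loc (Finmap.lookup_insert _) hmem).widen hG.flat' Finset.subset_union_right
      (hG.subset_obs hu.subset_obs.1) (Finset.empty_subset _) (hG.subset_obs hu.subset_obs.2)
  | deref σ₁ σ₂ E l v =>
    refine ⟨St, ∅, .refl hSt, hσ, ?_⟩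
    simp only [Finset.union_empty]
    refine ht.plug_replace hSt fun _ _ _ h => ?_
    obtain ⟨B, q', ε', rfl, h'⟩ := h.inv_deref rfl
    -- The content read is a constant, so it is typable with the empty qualifier and can be widened
    -- to whatever the hole had.
    obtain ⟨-, c, rfl, hc⟩ := hσ.cell_of_loc h'
    exact (HasType.cst hc).widen hSt (Finset.empty_subset _) h.subset_obs.1
      (Finset.empty_subset _) h.subset_obs.2
  | assign σ₁ σ₂ E l v v' hv' =>
    have hc : ∃ B c, St.lookup l = some (.ref B, ∅) ∧ v' = .cst c ∧ S.mem c B := by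
      obtain ⟨Tu, qu, εu, hu, -⟩ := ht.replaceable rfl rfl hSt rfl
      obtain ⟨B, q', ε₁, ε₂, -, h₁, h₂⟩ := hu.inv_assign rfl
      obtain ⟨c, hc⟩ := h₂.value_base hv' rfl rfl
      exact ⟨B, c, (hσ.cell_of_loc h₁).1, hc⟩
    refine ⟨St, ∅, .refl hSt, ⟨hSt, fun k => ?_, fun k w hk => ?_⟩, ?_⟩
    · rw [← hσ.dom]; simp [Store.dom]
    · rw [List.mem_append, List.mem_cons] at hk
      rcases hk with hk | hk | hk
      · exact hσ.cell k w (by simp [hk])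
      · cases hk; exact hc
      · exact hσ.cell k w (by simp [hk])
    · simp only [Finset.union_empty]
      refine ht.plug_replace hSt fun _ _ _ h => ?_
      obtain ⟨B, q', ε₁, ε₂, rfl, -, -⟩ := h.inv_assign rfl
      exact (HasType.cst S.unit_mem).widen hSt (Finset.empty_subset _) h.subset_obs.1
        (Finset.empty_subset _) h.subset_obs.2

end LambdaStar

/-- Preservation of separation: interleaved executions of two closed terms with disjoint qualifiers
preserve types and disjointness. -/
theorem mainTheorem10 (S : LambdaStar.Sig) (St : LambdaStar.StoreTy S)
    (σ σ' σ'' : LambdaStar.Store S) (t₁ t₁' t₂ t₂' : LambdaStar.Tm S)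
    (T₁ T₂ : LambdaStar.Ty S) (q₁ q₂ ε₁ ε₂ : LambdaStar.Qual)
    (ht₁ : LambdaStar.HasType [] St St.obs t₁ T₁ q₁ ε₁)
    (ht₂ : LambdaStar.HasType [] St St.obs t₂ T₂ q₂ ε₂)
    (hσ : LambdaStar.WfStore [] St.obs St σ)
    (hstep₁ : LambdaStar.Step σ t₁ σ' t₁')
    (hstep₂ : LambdaStar.Step σ' t₂ σ'' t₂')
    (hq : q₁ ∩ q₂ ⊆ ∅) :
    ∃ (p₁ p₂ ε₁' ε₂' : LambdaStar.Qual) (St' St'' : LambdaStar.StoreTy S),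
      St'.WellScoped ∧ St''.WellScoped ∧
      St'.Extends St ∧ St''.Extends St' ∧
      LambdaStar.HasType [] St' St'.obs t₁' T₁ p₁ ε₁' ∧
      LambdaStar.HasType [] St'' St''.obs t₂' T₂ p₂ ε₂' ∧
      p₁ ∩ p₂ ⊆ ∅ := by
  obtain ⟨St', F₁, hG₁, hσ₁, h₁⟩ := hstep₁.preservation hσ.consistent ht₁
  -- The second term runs in the store left by the first, so its typing is first weakened; its
  -- qualifier `q₂` does not change.
  obtain ⟨St'', F₂, hG₂, -, h₂⟩ := hstep₂.preservation hσ₁ (hG₁.weaken ht₂)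
  refine ⟨_, _, _, _, St', St'', hG₁.flat'.wellScoped, hG₂.flat'.wellScoped, hG₁.ext, hG₂.ext,
    h₁, h₂, ?_⟩
  -- First `F₂` is dropped, as it is fresh for `q₁ ∪ F₁`; then `F₁`, as it is fresh for `q₂`. What
  -- remains is `q₁ ∩ q₂`.
  rw [hG₂.inter_union (hG₁.subset_obs ht₁.subset_obs.1), Finset.inter_comm,
    hG₁.inter_union ht₂.subset_obs.1, Finset.inter_comm]
  exact hq
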